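/- **Setting.** An agent chooses actions from $A=\{1,\dots,|A|\}$ given a state $(x,\epsilon)$, with $x$ in a finite set $X$ and $\epsilon\in\mathbb R^{|A|}$, discount factor $\beta\in(0,1)$, utility $u_{\alpha}(x,a)+\epsilon(a)$, density $g_{\alpha}(\epsilon|x)$ of $\epsilon$ given $x$, and transition probabilities $f_{\theta_f}(x'|x,a)$. Here $\alpha\in\Theta_\alpha\subset\mathbb R^{d_\alpha}$ and $\theta_f\in\Theta_f\subset\mathbb R^{d_f}$, both parameter spaces being compact; write $\theta=(\alpha,\theta_f)$. Let $\tilde A=A\setminus\{|A|\}$ and let $\Theta_P$ be the set of vectors $P=\{P(a|x)\}_{(a,x)\in\tilde A\times X}$ for which every action, including $|A|$ with $P(|A||x)=1-\sum_{a\in\tilde A}P(a|x)$, has positive probability in every state. For $V\in\mathbb R^X$ let $\Lambda_\theta(V)$ be the vector of probabilities, under $g_\alpha(\cdot|x)$, that $a\in\tilde A$ maximizes $u_\alpha(x,a)+\beta\sum_{x'}V(x')f_{\theta_f}(x'|x,a)+\epsilon(a)$. Let $V_\theta$ be the solution of the smoothed Bellman equation $V(x)=\int\max_a\{u_\alpha(x,a)+\epsilon(a)+\beta\sum_{x'}V(x')f_{\theta_f}(x'|x,a)\}g_\alpha(\epsilon|x)\,d\epsilon$,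 and let $P_\theta=\Lambda_\theta(V_\theta)$. For $P\in\Theta_P$ let $\varphi_\theta(P)$ be the solution $V$ of $V(x)=\sum_aP(a|x)\{u_\alpha(x,a)+e_a(x,P)+\beta\sum_{x'}V(x')f_{\theta_f}(x'|x,a)\}$, where $e_a(x,P)$ is the mean of $\epsilon(a)$ given $x$ and that $a$ is optimal, when the choice-specific values (normalized to $0$ for action $|A|$) are those that generate the choice probabilities $P(\cdot|x)$. Let $\Psi_\theta=\Lambda_\theta\circ\varphi_\theta$. **Assumptions on the model and the DGPs.** 1. For every $\theta\in\Theta_\alpha\times\Theta_f$ and $x$: $g_\alpha(\cdot|x)$ has finite first moments, is twice differentiable in $\epsilon$ and has full support; $g,u$ are twice continuously differentiable in $\alpha$ and $f$ in $\theta_f$. 2. $f_{\theta_f}$ identifies $\theta_f$; and for every $\theta_f\in\Theta_f$, $P\in\Theta_P$, at most one $\alpha\in\Theta_\alpha$ satisfies $\Psi_{(\alpha,\theta_f)}(P)=P$. 3. The DGPs $\Pi_n^*$ (probability distributions on $A\times X\times X$) satisfy $n^\delta(\Pi_n^*-\Pi^*)\to B$ for some finite $B$ and some $\delta>0$. Their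 CCPs $P^*_n$ and transition probabilities $f^*_n$ converge to $P^*$ and $f^*$, and $\inf_\theta\|(P_\theta-P^*,f_{\theta_f}-f^*)\|=0$. The pair $(\alpha^*,\theta_f^*)\in\Theta_\alpha\times\Theta_f$ is the one with $P_{(\alpha^*,\theta_f^*)}=P^*$ and $f_{\theta_f^*}=f^*$. 4. $\alpha^*$ is interior to $\Theta_\alpha$. 5. $(\alpha,\theta_f,P)\mapsto\Psi_{(\alpha,\theta_f)}(P)$ is continuously differentiable on $\Theta_\alpha\times\Theta_f\times\Theta_P$ near $(\alpha^*,\theta_f^*,P^*)$. **Estimator.** For each $n$, on a probability space with probability $p_n$, let $\hat\theta_{f,n}$ and $\hat P^0_n$ be preliminary estimators with values in $\Theta_f$, $\Theta_P$, let $Q_n(\alpha,\theta_f,P)$ be a random criterion function, and for $k=1,2,\dots,K$ let $$\hat\alpha^k_n\in\arg\max_{\alpha\in\Theta_\alpha}Q_n(\alpha,\hat\theta_{f,n},\hat P_n^{k-1}),\qquad \hat P^k_n=\Psi_{(\hat\alpha^k_n,\hat\theta_{f,n})}(\hat P^{k-1}_n)\quad(k<K).$$ It is enough that these relations hold with $p_n$-probability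 approaching one (w.p.a.1). The estimators are measurable. **High-level conditions.** Below, $o_{p_n}(1)$, $O_{p_n}(1)$ and $\overset d\to$ are along $\{p_n\}$. There are a (non-random) function $Q_\infty$ and a neighborhood $\mathcal N$ of $(\alpha^*,\theta_f^*,P^*)$, on which $Q_n$ and $Q_\infty$ are defined, such that, with $\lambda$ ranging over $\alpha,\theta_f,P$ in (c) and (d): - (a) $\sup_{\alpha\in\Theta_\alpha}|Q_n(\alpha,\hat\theta_{f,n},\tilde P_n)-Q_\infty(\alpha,\theta_f^*,P^*)|=o_{p_n}(1)$ for all random $\tilde P_n\in\Theta_P$ with $\tilde P_n=P^*+o_{p_n}(1)$; - (b) $Q_\infty(\cdot,\theta_f^*,P^*)$ is upper semicontinuous on $\Theta_\alpha$ and uniquely maximized there at $\alpha^*$; - (c) w.p.a.1, $\partial^2Q_n/\partial\alpha\partial\lambda'$ exists and is continuous on $\mathcal N$; - (d) $\partial^2Q_\infty/\partial\alpha\partial\lambda'$ exists on $\mathcal N$ and $\sup_{\mathcal N}\|\partial^2Q_n/\partial\alpha\partial\lambda'-\partial^2Q_\infty/\partial\alpha\partial\lambda'\|=o_{p_n}(1)$;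 - (e) $\partial^2Q_\infty/\partial\alpha\partial\alpha'$ is continuous and non-singular at $(\alpha^*,\theta_f^*,P^*)$; - (f) $\partial^2Q_\infty/\partial\lambda\partial P'=0$ at $(\alpha^*,\theta_f^*,P^*)$ for $\lambda\in\{\alpha,\theta_f\}$; - (g) $n^{\min\{1/2,\delta\}}\big(\partial Q_n(\alpha^*,\theta_f^*,P^*)/\partial\alpha,\ \hat\theta_{f,n}-\theta_f^*\big)\overset d\to\zeta=(\zeta_1,\zeta_2)$ for some random vector $\zeta$; - (h) $n^{\min\{1/2,\delta\}}(\hat P^0_n-P^*)=O_{p_n}(1)$. **Theorem.** Let $H=\partial^2Q_\infty(\alpha^*,\theta_f^*,P^*)/\partial\alpha\partial\alpha'$ and $G=\partial^2Q_\infty(\alpha^*,\theta_f^*,P^*)/\partial\alpha\partial\theta_f'$. For every $K\ge1$, $$n^{\min\{1/2,\delta\}}(\hat\alpha^K_n-\alpha^*)=-H^{-1}n^{\min\{1/2,\delta\}}\Big[\frac{\partial Q_n(\alpha^*,\theta_f^*,P^*)}{\partial\alpha}+G(\hat\theta_{f,n}-\theta_f^*)\Big]+o_{p_n}(1)\ \overset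 d\to\ -H^{-1}[\zeta_1+G\zeta_2].$$ In particular the limit does not depend on $K$. -/

import Mathlib

open MeasureTheory ProbabilityTheory Filter Topology
open scoped ENNReal

noncomputable section

namespace DDC

/-! ### Parameter and CCP vectors -/

/-- Euclidean parameter space of dimension `d`. -/
abbrev Vec (d : ℕ) : Type := EuclideanSpace ℝ (Fin d)

/-- Vectors `{P(a|x)}` indexed by the actions other than the last one, and by the states.
The actions are `Fin (J + 1)`, the last one being `Fin.last J`; the states are `Fin S`. -/
abbrev CCPVec (J S : ℕ) : Type := EuclideanSpace ℝ (Fin J × Fin S)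

/-- The choice probabilities of all `J + 1` actions in state `x`; the probability of the last
action is one minus the sum of the others. -/
def fullCCP {J S : ℕ} (P : CCPVec J S) (x : Fin S) : Fin (J + 1) → ℝ :=
  Fin.snoc (fun b : Fin J => P (b, x)) (1 - ∑ b : Fin J, P (b, x))

/-- The space of CCP vectors: every action has positive probability in every state. -/
def ccpSpace (J S : ℕ) : Set (CCPVec J S) :=
  {P | ∀ x a, 0 < fullCCP P x a}

/-! ### The econometric model -/

/-- The single-agent dynamic discrete choice model with `J + 1` actions and `S` observed states.
The parameter `α` governs utility and the unobserved state, and `τ` (written `θ_f` in prose)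
governs the transition of the observed state. -/
structure Model (dα df J S : ℕ) where
  /-- discount factor -/
  β : ℝ
  β_pos : 0 < β
  β_lt_one : β < 1
  /-- parameter space of `α` -/
  Θα : Set (Vec dα)
  /-- parameter space of `θ_f` -/
  Θf : Set (Vec df)
  compact_Θα : IsCompact Θα
  compact_Θf : IsCompact Θf
  /-- per-period utility `u α x a` -/
  u : Vec dα → Fin S → Fin (J + 1) → ℝ
  /-- density `g α x ε` of the unobserved state given `x` -/
  g : Vec dα → Fin S → (Fin (J + 1) → ℝ) → ℝ
  g_nonneg : ∀ α ∈ Θα, ∀ x ε, 0 ≤ g α x ε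
  g_integrable : ∀ α ∈ Θα, ∀ x, Integrable (g α x)
  g_integral : ∀ α ∈ Θα, ∀ x, ∫ ε, g α x ε = 1
  /-- transition probability `f τ x a x'` of `x'` given `(x, a)` -/
  f : Vec df → Fin S → Fin (J + 1) → Fin S → ℝ
  f_nonneg : ∀ τ ∈ Θf, ∀ x a x', 0 ≤ f τ x a x'
  f_sum : ∀ τ ∈ Θf, ∀ x a, ∑ x', f τ x a x' = 1

variable {dα df J S : ℕ}

/-- The event that `a` is the maximizer of `b ↦ v b + ε b`. -/
def optimalSet (v : Fin (J + 1) → ℝ) (a : Fin (J + 1)) : Set (Fin (J + 1) → ℝ) :=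
  {ε | ∀ b, b ≠ a → v b + ε b < v a + ε a}

namespace Model

variable (M : Model dα df J S)

/-- Probability that action `a` is optimal in state `x` when the choice-specific values are `v`. -/
def choiceProb (α : Vec dα) (x : Fin S) (v : Fin (J + 1) → ℝ) (a : Fin (J + 1)) : ℝ :=
  ∫ ε in optimalSet v a, M.g α x ε

/-- Mean of `ε a` conditional on `a` being optimal in state `x` when the values are `v`. -/
def meanShock (α : Vec dα) (x : Fin S) (v : Fin (J + 1) → ℝ) (a : Fin (J + 1)) : ℝ :=
  (∫ ε in optimalSet v a, ε a * M.g α x ε) / M.choiceProb α x v a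

/-- Choice-specific values (net of `ε`) when the smoothed value function is `V`. -/
def choiceValue (α : Vec dα) (τ : Vec df) (V : Fin S → ℝ) (x : Fin S) (a : Fin (J + 1)) : ℝ :=
  M.u α x a + M.β * ∑ x', V x' * M.f τ x a x'

/-- `V` solves the smoothed Bellman equation. -/
def IsSmoothedValue (α : Vec dα) (τ : Vec df) (V : Fin S → ℝ) : Prop :=
  ∀ x, V x = ∫ ε, (⨆ a, (M.choiceValue α τ V x a + ε a)) * M.g α x ε

/-- The smoothed value function: the solution of the smoothed Bellman equation. -/
def value (α : Vec dα) (τ : Vec df) : Fin S → ℝ :=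
  Classical.epsilon (M.IsSmoothedValue α τ)

/-- The map `Λ` from smoothed value functions to CCPs. -/
def Lam (α : Vec dα) (τ : Vec df) (V : Fin S → ℝ) : CCPVec J S :=
  WithLp.toLp 2 fun ax => M.choiceProb α ax.2 (M.choiceValue α τ V ax.2) ax.1.castSucc

/-- The model-implied CCPs `P_θ`. -/
def ccp (α : Vec dα) (τ : Vec df) : CCPVec J S := M.Lam α τ (M.value α τ)

/-- The inverse of the map from normalized choice-specific values (zero for the last action) to
choice probabilities, in state `x`. -/
def normalizedValue (α : Vec dα) (x : Fin S) (p : Fin (J + 1) → ℝ) : Fin (J + 1) → ℝ :=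
  Classical.epsilon fun v => v (Fin.last J) = 0 ∧ ∀ a, M.choiceProb α x v a = p a

/-- The flow payoff `∑ₐ P(a|x) {u(x,a) + E[ε(a)|x,a]}` of behaving according to `P`, where the
conditional mean of `ε(a)` is expressed through the CCPs. -/
def flowPayoff (α : Vec dα) (P : CCPVec J S) (x : Fin S) : ℝ :=
  ∑ a, fullCCP P x a *
    (M.u α x a + M.meanShock α x (M.normalizedValue α x (fullCCP P x)) a)

/-- The Markov matrix of the observed state under the CCPs `P`. -/
def stateMatrix (τ : Vec df) (P : CCPVec J S) : Matrix (Fin S) (Fin S) ℝ :=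
  Matrix.of fun x x' => ∑ a, fullCCP P x a * M.f τ x a x'

/-- The map `φ`: the smoothed value of behaving according to `P` for ever, i.e. the solution of
`V(x) = ∑ₐ P(a|x) {u(x,a) + E[ε(a)|x,a] + β ∑ₓ' V(x') f(x'|x,a)}`. -/
def phi (α : Vec dα) (τ : Vec df) (P : CCPVec J S) : Fin S → ℝ :=
  (1 - M.β • M.stateMatrix τ P)⁻¹.mulVec (M.flowPayoff α P)

/-- The policy function mapping `Ψ = Λ ∘ φ`. -/
def Psi (α : Vec dα) (τ : Vec df) (P : CCPVec J S) : CCPVec J S :=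
  M.Lam α τ (M.phi α τ P)

/-- Regularity of the primitives. -/
structure Regular : Prop where
  finite_moment : ∀ α ∈ M.Θα, ∀ x, Integrable fun ε => ‖ε‖ * M.g α x ε
  diff_eps : ∀ α ∈ M.Θα, ∀ x, Differentiable ℝ (M.g α x)
  diff_eps_two : ∀ α ∈ M.Θα, ∀ x, Differentiable ℝ (fderiv ℝ (M.g α x))
  full_support : ∀ α ∈ M.Θα, ∀ x,
    (volume.withDensity fun ε => ENNReal.ofReal (M.g α x ε)).IsOpenPosMeasure
  smooth_g : ∀ x ε, ContDiffOn ℝ 2 (fun α => M.g α x ε) M.Θα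
  smooth_u : ∀ x a, ContDiffOn ℝ 2 (fun α => M.u α x a) M.Θα
  smooth_f : ∀ x a x', ContDiffOn ℝ 2 (fun τ => M.f τ x a x') M.Θf

/-- Identification of `θ_f` from the transition probabilities and of `α` from the fixed point
condition. -/
structure Identified : Prop where
  ident_f : ∀ τ₁ ∈ M.Θf, ∀ τ₂ ∈ M.Θf, M.f τ₁ = M.f τ₂ → τ₁ = τ₂
  ident_α : ∀ τ ∈ M.Θf, ∀ P ∈ ccpSpace J S, ∀ α₁ ∈ M.Θα, ∀ α₂ ∈ M.Θα,
    M.Psi α₁ τ P = P → M.Psi α₂ τ P = P → α₁ = α₂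

end Model

/-! ### Data generating processes and local misspecification -/

/-- Joint probability mass functions `p a x x'`. -/
structure IsDGP (p : Fin (J + 1) → Fin S → Fin S → ℝ) : Prop where
  nonneg : ∀ a x x', 0 ≤ p a x x'
  sum_eq_one : ∑ a, ∑ x, ∑ x', p a x x' = 1

/-- CCPs of a DGP. -/
def dgpCCP (p : Fin (J + 1) → Fin S → Fin S → ℝ) : CCPVec J S :=
  WithLp.toLp 2 fun ax =>
    (∑ x', p ax.1.castSucc ax.2 x') / ∑ a, ∑ x', p a ax.2 x'

/-- Transition probabilities of a DGP. -/
def dgpTrans (p : Fin (J + 1) → Fin S → Fin S → ℝ) (x : Fin S) (a : Fin (J + 1)) (x' : Fin S) :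
    ℝ :=
  p a x x' / ∑ y, p a x y

/-- Local misspecification at rate `n ^ δ` along the DGPs `p n`, with limiting DGP `p0`, limiting
CCPs `Pstar` and limiting transition probabilities `fstar`. -/
structure LocallyMisspecified (M : Model dα df J S) (δ : ℝ)
    (p : ℕ → Fin (J + 1) → Fin S → Fin S → ℝ) (p0 : Fin (J + 1) → Fin S → Fin S → ℝ)
    (Pstar : CCPVec J S) (fstar : Fin S → Fin (J + 1) → Fin S → ℝ) : Prop where
  dgp : ∀ n, IsDGP (p n)
  δ_pos : 0 < δ
  drift : ∃ B : Fin (J + 1) → Fin S → Fin S → ℝ,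
    Tendsto (fun n : ℕ => (n : ℝ) ^ δ • (p n - p0)) atTop (𝓝 B)
  lim_ccp : Tendsto (fun n => dgpCCP (p n)) atTop (𝓝 Pstar)
  lim_trans : Tendsto (fun n => dgpTrans (p n)) atTop (𝓝 fstar)
  correct_in_limit :
    sInf ((fun θ : Vec dα × Vec df =>
      √(‖M.ccp θ.1 θ.2 - Pstar‖ ^ 2 + ∑ x, ∑ a, ∑ x', (M.f θ.2 x a x' - fstar x a x') ^ 2)) ''
        (M.Θα ×ˢ M.Θf)) = 0

/-- The true limiting parameter value `(αs, τs)`. -/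
structure IsTrueParameter (M : Model dα df J S) (Pstar : CCPVec J S)
    (fstar : Fin S → Fin (J + 1) → Fin S → ℝ) (αs : Vec dα) (τs : Vec df) : Prop where
  mem_α : αs ∈ M.Θα
  mem_f : τs ∈ M.Θf
  ccp_eq : M.ccp αs τs = Pstar
  trans_eq : M.f τs = fstar

/-! ### Stochastic orders along a drifting sequence of probability spaces -/

section Orders

variable {Ω : ℕ → Type*} [∀ n, MeasurableSpace (Ω n)] (μ : ∀ n, Measure (Ω n))

/-- With probability approaching one. -/
def WPA1 (p : ∀ n, Ω n → Prop) : Prop :=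
  Tendsto (fun n => μ n {ω | ¬ p n ω}) atTop (𝓝 0)

/-- `o_p(1)`, for nonnegative extended real sequences such as norms and suprema of norms. -/
def IsLittleOp (Y : ∀ n, Ω n → ℝ≥0∞) : Prop :=
  ∀ ε : ℝ≥0∞, 0 < ε → Tendsto (fun n => μ n {ω | ε ≤ Y n ω}) atTop (𝓝 0)

/-- `O_p(1)`. -/
def IsBigOp {E : Type*} [Norm E] (Y : ∀ n, Ω n → E) : Prop :=
  ∀ ε : ℝ≥0∞, 0 < ε → ∃ C : ℝ, ∀ᶠ n in atTop, μ n {ω | C < ‖Y n ω‖} ≤ ε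

end Orders

/-- The rate `n ^ min {1/2, δ}`. -/
def rate (δ : ℝ) (n : ℕ) : ℝ := (n : ℝ) ^ min (1 / 2) δ

/-! ### Criterion functions and their partial derivatives -/

/-- Criterion functions `Q α θ_f P`. -/
abbrev Criterion (dα df J S : ℕ) : Type := Vec dα → Vec df → CCPVec J S → ℝ

namespace Criterion

variable (Q : Criterion dα df J S) (a : Vec dα) (t : Vec df) (P : CCPVec J S)

/-- `∂Q/∂α`. -/
def dA : Vec dα := gradient (fun a' => Q a' t P) a

/-- `∂²Q/∂α∂α'`. -/
def dAA : Vec dα →L[ℝ] Vec dα := fderiv ℝ (fun a' => dA Q a' t P) a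

/-- `∂²Q/∂α∂θ_f'`. -/
def dAF : Vec df →L[ℝ] Vec dα := fderiv ℝ (fun t' => dA Q a t' P) t

/-- `∂²Q/∂α∂P'`. -/
def dAP : CCPVec J S →L[ℝ] Vec dα := fderiv ℝ (fun P' => dA Q a t P') P

/-- `∂Q/∂θ_f`. -/
def dF : Vec df := gradient (fun t' => Q a t' P) t

/-- The derivatives `∂Q/∂α` and `∂²Q/∂α∂λ'`, for `λ ∈ {α, θ_f, P}`, exist at a point. -/
structure HasPartials : Prop where
  dA : DifferentiableAt ℝ (fun a' => Q a' t P) a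
  dAA : DifferentiableAt ℝ (fun a' => Criterion.dA Q a' t P) a
  dAF : DifferentiableAt ℝ (fun t' => Criterion.dA Q a t' P) t
  dAP : DifferentiableAt ℝ (fun P' => Criterion.dA Q a t P') P

/-- The second derivatives `∂²Q/∂α∂λ'`, for `λ ∈ {α, θ_f, P}`, exist and are continuous on `N`. -/
structure SmoothOn (N : Set (Vec dα × Vec df × CCPVec J S)) : Prop where
  exist : ∀ y ∈ N, HasPartials Q y.1 y.2.1 y.2.2
  cont_AA : ContinuousOn (fun y => dAA Q y.1 y.2.1 y.2.2) N
  cont_AF : ContinuousOn (fun y => dAF Q y.1 y.2.1 y.2.2) N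
  cont_AP : ContinuousOn (fun y => dAP Q y.1 y.2.1 y.2.2) N

end Criterion

/-- Regularity conditions on the sample criterion `Q` and its limit `Qinf`, relative to the
first-step estimator `τhat`. -/
structure CriterionConditions (M : Model dα df J S)
    {Ω : ℕ → Type*} [∀ n, MeasurableSpace (Ω n)] (μ : ∀ n, Measure (Ω n))
    (Q : ∀ n, Ω n → Criterion dα df J S) (Qinf : Criterion dα df J S)
    (τhat : ∀ n, Ω n → Vec df)
    (N : Set (Vec dα × Vec df × CCPVec J S))
    (αs : Vec dα) (τs : Vec df) (Pstar : CCPVec J S) : Prop where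
  nhds : N ∈ 𝓝 (αs, τs, Pstar)
  /-- uniform convergence in probability, along any consistent sequence of CCP estimators -/
  uniform : ∀ Ptil : ∀ n, Ω n → CCPVec J S, (∀ n, Measurable (Ptil n)) →
    (∀ n ω, Ptil n ω ∈ ccpSpace J S) →
    IsLittleOp μ (fun n ω => ‖Ptil n ω - Pstar‖ₑ) →
    IsLittleOp μ (fun n ω => ⨆ a ∈ M.Θα, ‖Q n ω a (τhat n ω) (Ptil n ω) - Qinf a τs Pstar‖ₑ)
  /-- unique maximizer of an upper semicontinuous limit criterion -/
  unique_max : ∀ a ∈ M.Θα, a ≠ αs → Qinf a τs Pstar < Qinf αs τs Pstar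
  usc : UpperSemicontinuousOn (fun a => Qinf a τs Pstar) M.Θα
  /-- continuous second derivatives with probability approaching one -/
  smooth : WPA1 μ fun n ω => (Q n ω).SmoothOn N
  /-- uniform convergence of the second derivatives -/
  exist_inf : ∀ y ∈ N, Qinf.HasPartials y.1 y.2.1 y.2.2
  conv_AA : IsLittleOp μ fun n ω =>
    ⨆ y ∈ N, ‖(Q n ω).dAA y.1 y.2.1 y.2.2 - Qinf.dAA y.1 y.2.1 y.2.2‖ₑ
  conv_AF : IsLittleOp μ fun n ω =>
    ⨆ y ∈ N, ‖(Q n ω).dAF y.1 y.2.1 y.2.2 - Qinf.dAF y.1 y.2.1 y.2.2‖ₑ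
  conv_AP : IsLittleOp μ fun n ω =>
    ⨆ y ∈ N, ‖(Q n ω).dAP y.1 y.2.1 y.2.2 - Qinf.dAP y.1 y.2.1 y.2.2‖ₑ
  /-- continuity and non-singularity of the limit Hessian -/
  cont_AA : ContinuousAt (fun y : Vec dα × Vec df × CCPVec J S => Qinf.dAA y.1 y.2.1 y.2.2)
    (αs, τs, Pstar)
  nonsingular : (Qinf.dAA αs τs Pstar).IsInvertible
  /-- zero cross derivative `∂²Qinf/∂α∂P'` -/
  cross_AP : Qinf.dAP αs τs Pstar = 0
  /-- zero cross derivative `∂²Qinf/∂θ_f∂P'` -/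
  exist_F : ∀ᶠ P in 𝓝 Pstar, DifferentiableAt ℝ (fun t' => Qinf αs t' P) τs
  cross_FP : HasFDerivAt (fun P => Qinf.dF αs τs P) (0 : CCPVec J S →L[ℝ] Vec df) Pstar

/-! ### The two-step `K`-stage policy iteration algorithm -/

/-- One realization of the algorithm run up to stage `K`: `t` is the first-step estimate of `θ_f`,
`P k` is the `k`-stage estimate of the CCPs and `a k` the `k`-stage estimate of `α`. -/
structure IsKStage (M : Model dα df J S) (Q : Criterion dα df J S) (K : ℕ)
    (t : Vec df) (P : ℕ → CCPVec J S) (a : ℕ → Vec dα) : Prop where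
  mem_f : t ∈ M.Θf
  mem_ccp : P 0 ∈ ccpSpace J S
  mem_α : ∀ k, 1 ≤ k → k ≤ K → a k ∈ M.Θα
  argmax : ∀ k, 1 ≤ k → k ≤ K → ∀ a' ∈ M.Θα, Q a' t (P (k - 1)) ≤ Q (a k) t (P (k - 1))
  update : ∀ k, 1 ≤ k → k < K → P k = M.Psi (a k) t (P (k - 1))

end DDC

end

/-! Write `r` for the rate. Linearizing the first-order condition of a stage at the true value gives
0 = score + H(α̂ - α*) + G(θ̂_f - θ_f*) + L(P̂ - P*) + o(errors), where L is the limit cross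
derivative in α and P. Since L = 0, an error of order 1/r in the CCPs contributes only o(1/r).
Inverting H yields an expansion of α̂ in which the CCPs do not appear
(`wpa1_norm_linearization_le`). The consistency that the linearization needs comes from uniform
convergence and a well-separated maximum (`isLittleOp_argmax_sub`).

The stages are tied together by induction. If the CCPs entering a stage have rate `r`, so has α̂
(`isLittleOp_and_isBigOp_stage`). As Ψ is differentiable at the true value, where it returns P*, the
updated CCPs have rate `r` as well (`isBigOp_smul_comp_sub`). Slutsky's lemma and the continuous
mapping theorem give the limit law.

That P* is a fixed point of Ψ is derived from the model (`Psi_ccp`). The surplus, E max (v + ε), is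
convex in v with the choice probabilities as a subgradient (`le_surplus`). So the expected shock
under optimal behaviour depends on v only through the choice probabilities, and the Bellman equation
becomes the linear system that defines φ. -/

namespace DDC

/-! ### Stochastic orders, tightness and Slutsky's lemma on varying probability spaces -/

section Orders

variable {Ω : ℕ → Type*} [∀ n, MeasurableSpace (Ω n)] {μ : ∀ n, Measure (Ω n)}

lemma WPA1.mono {p q : ∀ n, Ω n → Prop} (h : WPA1 μ p)
    (hpq : ∀ᶠ n in atTop, ∀ ω, p n ω → q n ω) : WPA1 μ q := by
  refine tendsto_of_tendsto_of_tendsto_of_le_of_le' tendsto_const_nhds h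
    (Eventually.of_forall fun _ => zero_le) ?_
  filter_upwards [hpq] with n hn
  exact measure_mono fun ω hω hp => hω (hn ω hp)

lemma WPA1.and {p q : ∀ n, Ω n → Prop} (hp : WPA1 μ p) (hq : WPA1 μ q) :
    WPA1 μ fun n ω => p n ω ∧ q n ω := by
  have h0 : Tendsto (fun n => μ n {ω | ¬ p n ω} + μ n {ω | ¬ q n ω}) atTop (𝓝 0) := by
    simpa using Tendsto.add hp hq
  refine tendsto_of_tendsto_of_tendsto_of_le_of_le tendsto_const_nhds h0 (fun _ => zero_le) ?_
  intro n
  refine (measure_mono fun ω hω => ?_).trans (measure_union_le _ _)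
  simp only [Set.mem_ofPred_eq, Set.mem_union] at hω ⊢
  tauto

lemma WPA1.of_forall {p : ∀ n, Ω n → Prop} (h : ∀ n ω, p n ω) : WPA1 μ p := by
  simp [WPA1, h]

/-- An event of probability approaching one occurs somewhere. -/
lemma WPA1.exists [∀ n, IsProbabilityMeasure (μ n)] {p : ∀ n, Ω n → Prop} (h : WPA1 μ p) :
    ∃ n ω, p n ω := by
  by_contra! hno
  have h1 : Tendsto (fun n => μ n {ω | ¬ p n ω}) atTop (𝓝 1) := by
    simp [hno]
  exact zero_ne_one (tendsto_nhds_unique h h1)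

lemma IsLittleOp.wpa1_lt {Y : ∀ n, Ω n → ℝ≥0∞} (h : IsLittleOp μ Y) {ε : ℝ≥0∞} (hε : 0 < ε) :
    WPA1 μ fun n ω => Y n ω < ε := by
  simpa [WPA1] using h ε hε

lemma isLittleOp_enorm_iff {E : Type*} [NormedAddCommGroup E] {X : ∀ n, Ω n → E} :
    IsLittleOp μ (fun n ω => ‖X n ω‖ₑ) ↔ ∀ η : ℝ, 0 < η → WPA1 μ fun n ω => ‖X n ω‖ < η := by
  constructor
  · intro h η hη
    refine (h.wpa1_lt (ENNReal.ofReal_pos.2 hη)).mono (Eventually.of_forall fun n ω hω => ?_)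
    rwa [← ofReal_norm, ENNReal.ofReal_lt_ofReal_iff hη] at hω
  · intro h ε hε
    -- The threshold may be infinite, so it is replaced by a smaller positive real.
    obtain ⟨r, hr0, hr⟩ := ENNReal.lt_iff_exists_nnreal_btwn.1 hε
    have hr0' : (0 : ℝ) < r := by exact_mod_cast hr0
    have := (h r hr0').mono (q := fun n ω => ‖X n ω‖ₑ < ε) (Eventually.of_forall fun n ω hω => by
      refine lt_of_lt_of_le ?_ hr.le
      rw [← ofReal_norm, ← ENNReal.ofReal_coe_nnreal, ENNReal.ofReal_lt_ofReal_iff hr0']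
      exact hω)
    simpa [WPA1] using this

/-- Union bound over three bad events: either bounding sequence is large, or the inequality fails.
All later transfers of rates go through this; a single bounding sequence is simply used twice. -/
lemma IsBigOp.of_wpa1_le {E E₁ E₂ : Type*} [NormedAddCommGroup E] [NormedAddCommGroup E₁]
    [NormedAddCommGroup E₂] {Y : ∀ n, Ω n → E} {X₁ : ∀ n, Ω n → E₁} {X₂ : ∀ n, Ω n → E₂}
    (h₁ : IsBigOp μ X₁) (h₂ : IsBigOp μ X₂) {c : ℝ} (hc : 0 ≤ c)
    (h : WPA1 μ fun n ω => ‖Y n ω‖ ≤ c * (‖X₁ n ω‖ + ‖X₂ n ω‖)) : IsBigOp μ Y := by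
  intro ε hε
  have hε3 : 0 < ε / 3 := ENNReal.div_pos hε.ne' (by norm_num)
  obtain ⟨C₁, hC₁⟩ := h₁ (ε / 3) hε3
  obtain ⟨C₂, hC₂⟩ := h₂ (ε / 3) hε3
  refine ⟨c * (C₁ + C₂), ?_⟩
  filter_upwards [hC₁, hC₂, ENNReal.tendsto_nhds_zero.1 h (ε / 3) hε3] with n h1 h2 h3
  calc μ n {ω | c * (C₁ + C₂) < ‖Y n ω‖}
      ≤ μ n (({ω | C₁ < ‖X₁ n ω‖} ∪ {ω | C₂ < ‖X₂ n ω‖}) ∪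
          {ω | ¬ ‖Y n ω‖ ≤ c * (‖X₁ n ω‖ + ‖X₂ n ω‖)}) := by
        refine measure_mono fun ω hω => ?_
        simp only [Set.mem_ofPred_eq, Set.mem_union] at hω ⊢
        by_contra! hcon
        obtain ⟨⟨ha, hb⟩, hY⟩ := hcon
        have := mul_le_mul_of_nonneg_left (add_le_add ha hb) hc
        linarith
    _ ≤ (ε / 3 + ε / 3) + ε / 3 :=
        (measure_union_le _ _).trans (add_le_add ((measure_union_le _ _).trans (add_le_add h1 h2)) h3)
    _ = ε := ENNReal.add_thirds ε

/-- A sequence that is `o(1)` times an `O_p(1)` sequence with probability approaching one is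
`o_p(1)`. -/
lemma isLittleOp_of_forall_le_mul {E E₁ : Type*} [NormedAddCommGroup E] [NormedAddCommGroup E₁]
    {R : ∀ n, Ω n → E} {Z : ∀ n, Ω n → E₁} (hZ : IsBigOp μ Z)
    (h : ∀ e : ℝ, 0 < e → WPA1 μ fun n ω => ‖R n ω‖ ≤ e * ‖Z n ω‖) :
    IsLittleOp μ fun n ω => ‖R n ω‖ₑ := by
  rw [isLittleOp_enorm_iff]
  intro η hη
  refine ENNReal.tendsto_nhds_zero.2 fun ε hε => ?_
  have hε2 : 0 < ε / 2 := ENNReal.half_pos hε.ne'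
  obtain ⟨C, hC⟩ := hZ (ε / 2) hε2
  have he : 0 < η / (|C| + 1) := by positivity
  filter_upwards [hC, ENNReal.tendsto_nhds_zero.1 (h _ he) (ε / 2) hε2] with n h1 h2
  calc μ n {ω | ¬ ‖R n ω‖ < η}
      ≤ μ n ({ω | C < ‖Z n ω‖} ∪ {ω | ¬ ‖R n ω‖ ≤ η / (|C| + 1) * ‖Z n ω‖}) := by
        refine measure_mono fun ω hω => ?_
        simp only [Set.mem_ofPred_eq, Set.mem_union] at hω ⊢
        by_contra! hcon
        obtain ⟨ha, hb⟩ := hcon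
        refine hω (hb.trans_lt ?_)
        have h3 : ‖Z n ω‖ < |C| + 1 := by linarith [le_abs_self C]
        calc η / (|C| + 1) * ‖Z n ω‖ < η / (|C| + 1) * (|C| + 1) := by gcongr
          _ = η := by field_simp
    _ ≤ ε / 2 + ε / 2 := (measure_union_le _ _).trans (add_le_add h1 h2)
    _ = ε := ENNReal.add_halves ε

/-- A sequence that is `O_p(1)` after multiplication by a diverging rate is `o_p(1)`. -/
lemma IsBigOp.isLittleOp_of_smul {E : Type*} [NormedAddCommGroup E] [NormedSpace ℝ E]
    {X : ∀ n, Ω n → E} {r : ℕ → ℝ} (hr : Tendsto r atTop atTop)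
    (h : IsBigOp μ fun n ω => r n • X n ω) : IsLittleOp μ fun n ω => ‖X n ω‖ₑ := by
  refine isLittleOp_of_forall_le_mul h fun e he => WPA1.mono (WPA1.of_forall (p := fun _ _ => True)
    fun _ _ => trivial) ?_
  -- Once `r n ≥ 1/e`, the factor `e * r n` is at least one, so the bound holds surely.
  filter_upwards [hr.eventually_ge_atTop e⁻¹] with n hn ω _
  have hrn : 0 ≤ r n := (inv_pos.2 he).le.trans hn
  rw [norm_smul, Real.norm_of_nonneg hrn, ← mul_assoc]
  have : 1 ≤ e * r n := by
    calc 1 = e * e⁻¹ := by field_simp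
      _ ≤ e * r n := by gcongr
  exact le_mul_of_one_le_left (norm_nonneg _) this

/-- Convergence in distribution implies boundedness in probability. -/
lemma isBigOp_of_tendstoInDistribution [∀ n, IsProbabilityMeasure (μ n)]
    {E : Type*} [NormedAddCommGroup E] [MeasurableSpace E] [BorelSpace E]
    {Ω' : Type*} [MeasurableSpace Ω'] {μ' : Measure Ω'} [IsProbabilityMeasure μ']
    {X : ∀ n, Ω n → E} {Z : Ω' → E} (h : TendstoInDistribution X atTop Z μ μ') :
    IsBigOp μ X := by
  intro ε hε
  -- These closed tails decrease to the empty set, so the limit law gives some `F m` mass below ε.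
  -- The portmanteau inequality for closed sets carries this over to large `n`.
  set F : ℕ → Set E := fun m => {x | (m : ℝ) ≤ ‖x‖}
  have hFc : ∀ m, IsClosed (F m) := fun m => isClosed_le continuous_const continuous_norm
  have := Measure.isProbabilityMeasure_map (μ := μ') h.aemeasurable_limit
  have hlim : Tendsto (fun m => μ'.map Z (F m)) atTop (𝓝 0) := by
    have h1 := tendsto_measure_iInter_atTop (μ := μ'.map Z) (s := F)
      (fun m => (hFc m).measurableSet.nullMeasurableSet)
      (fun a b hab x (hx : (b : ℝ) ≤ ‖x‖) => show (a : ℝ) ≤ ‖x‖ from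
        (Nat.cast_le.2 hab).trans hx) ⟨0, measure_ne_top _ _⟩
    have h2 : ⋂ m, F m = ∅ := by
      ext x
      simp only [F, Set.mem_iInter, Set.mem_ofPred_eq, Set.mem_empty_iff_false, iff_false, not_forall,
        not_le]
      exact exists_nat_gt ‖x‖
    simpa [h2, Function.comp_def] using h1
  obtain ⟨m, hm⟩ := (hlim.eventually_lt_const hε).exists
  refine ⟨m, ?_⟩
  have h3 := ProbabilityMeasure.limsup_measure_closed_le_of_tendsto h.tendsto (hFc m)
  filter_upwards [eventually_lt_of_limsup_lt (h3.trans_lt hm)] with n hn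
  refine le_trans (measure_mono fun ω hω => ?_)
    (((Measure.map_apply_of_aemeasurable (h.forall_aemeasurable n)
      (hFc m).measurableSet).symm.le).trans hn.le)
  exact (show (m : ℝ) < ‖X n ω‖ from hω).le

/-- Slutsky's lemma along a sequence of probability spaces. -/
lemma tendstoInDistribution_of_isLittleOp_sub [∀ n, IsProbabilityMeasure (μ n)]
    {E : Type*} [NormedAddCommGroup E] [MeasurableSpace E] [BorelSpace E]
    {Ω' : Type*} [MeasurableSpace Ω'] {μ' : Measure Ω'} [IsProbabilityMeasure μ']
    {X Y : ∀ n, Ω n → E} {Z : Ω' → E} (h : TendstoInDistribution X atTop Z μ μ')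
    (hY : ∀ n, AEMeasurable (Y n) (μ n))
    (hXY : IsLittleOp μ fun n ω => ‖Y n ω - X n ω‖ₑ) :
    TendstoInDistribution Y atTop Z μ μ' := by
  refine ⟨hY, h.aemeasurable_limit, ?_⟩
  have := Measure.isProbabilityMeasure_map (μ := μ') h.aemeasurable_limit
  refine tendsto_of_forall_isClosed_limsup_le' fun F hF => ?_
  refine ENNReal.le_of_forall_pos_le_add fun ε hε _ => ?_
  have hε' : (0 : ℝ≥0∞) < ε := by exact_mod_cast hε
  -- If Y lies in F and is within η of X, then X lies in the closed η-thickening of F. Its mass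
  -- under the limit law decreases to that of F as η → 0, which gives the closed-set criterion.
  have hthick : Tendsto (fun η => μ'.map Z (Metric.cthickening η F)) (𝓝[>] 0) (𝓝 (μ'.map Z F)) :=
    (tendsto_measure_cthickening_of_isClosed ⟨1, one_pos, measure_ne_top _ _⟩ hF).mono_left
      nhdsWithin_le_nhds
  have hlt : μ'.map Z F < μ'.map Z F + ε := ENNReal.lt_add_right (measure_ne_top _ _) hε'.ne'
  obtain ⟨η, hη, hη0⟩ := ((hthick.eventually_lt_const hlt).and self_mem_nhdsWithin).exists
  have hη0 : 0 < η := hη0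
  have hcl : IsClosed (Metric.cthickening η F) := Metric.isClosed_cthickening
  have h3 := ProbabilityMeasure.limsup_measure_closed_le_of_tendsto h.tendsto hcl
  have h4 := isLittleOp_enorm_iff.1 hXY η hη0
  refine (limsup_le_limsup (v := fun n => (μ n).map (X n) (Metric.cthickening η F) +
    μ n {ω | ¬ ‖Y n ω - X n ω‖ < η}) (Eventually.of_forall fun n => ?_)).trans ?_
  · simp only [ProbabilityMeasure.coe_mk]
    rw [Measure.map_apply_of_aemeasurable (hY n) hF.measurableSet,
      Measure.map_apply_of_aemeasurable (h.forall_aemeasurable n) hcl.measurableSet]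
    refine (measure_mono fun ω hω => ?_).trans (measure_union_le _ _)
    by_cases hd : ‖Y n ω - X n ω‖ < η
    · left
      refine Metric.mem_cthickening_of_dist_le _ (Y n ω) _ _ hω ?_
      rw [dist_comm, dist_eq_norm]
      exact hd.le
    · exact Or.inr hd
  · exact (ENNReal.limsup_add_of_right_tendsto_zero h4 _).le.trans (h3.trans hη.le)

end Orders

end DDC

namespace DDC

/-! ### Partition of the shock space by the optimal action -/

section Ties

variable {J : ℕ}

lemma isOpen_optimalSet (v : Fin (J + 1) → ℝ) (a : Fin (J + 1)) : IsOpen (optimalSet v a) := by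
  have : optimalSet v a = ⋂ b, ⋂ (_ : b ≠ a), {ε | v b + ε b < v a + ε a} := by
    ext ε; simp [optimalSet]
  rw [this]
  exact isOpen_iInter_of_finite fun b => isOpen_iInter_of_finite fun _ =>
    isOpen_lt (by fun_prop) (by fun_prop)

lemma optimalSet_nonempty (v : Fin (J + 1) → ℝ) (a : Fin (J + 1)) : (optimalSet v a).Nonempty := by
  refine ⟨fun b => if b = a then 1 - v a else - v b, fun b hb => ?_⟩
  simp [hb]

lemma pairwise_disjoint_optimalSet (v : Fin (J + 1) → ℝ) :
    Pairwise (Function.onFun Disjoint (optimalSet v)) := by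
  intro a b hab
  refine Set.disjoint_left.2 fun ε ha hb => ?_
  exact lt_asymm (ha b hab.symm) (hb a hab)

lemma optimalSet_add_const (v : Fin (J + 1) → ℝ) (c : ℝ) (a : Fin (J + 1)) :
    optimalSet (fun b => v b + c) a = optimalSet v a := by
  ext ε
  refine forall₂_congr fun b _ => ?_
  constructor <;> intro h <;> linarith

/-- The set is a proper affine subspace, a translate of the kernel of a nonzero functional. Hence
ties have probability zero under any density. -/
lemma volume_setOf_sub_eq {a b : Fin (J + 1)} (hab : a ≠ b) (c : ℝ) :
    volume {ε : Fin (J + 1) → ℝ | ε a - ε b = c} = 0 := by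
  let L : (Fin (J + 1) → ℝ) →ₗ[ℝ] ℝ := LinearMap.proj (R := ℝ) (φ := fun _ => ℝ) a - LinearMap.proj b
  let s : AffineSubspace ℝ (Fin (J + 1) → ℝ) := AffineSubspace.mk' (Pi.single a c) (LinearMap.ker L)
  have hs : s ≠ ⊤ := by
    intro h
    have h1 : LinearMap.ker L = ⊤ := by
      have := congrArg AffineSubspace.direction h
      simpa [s] using this
    have h2 : (Pi.single a 1 : Fin (J + 1) → ℝ) ∈ LinearMap.ker L := by rw [h1]; trivial
    simp [L, hab.symm] at h2
  have hset : {ε : Fin (J + 1) → ℝ | ε a - ε b = c} = s := by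
    ext ε
    have : ε ∈ s ↔ ε - Pi.single a c ∈ LinearMap.ker L := AffineSubspace.mem_mk'
    rw [SetLike.mem_coe, this]
    simp only [Set.mem_ofPred_eq, L, LinearMap.mem_ker, LinearMap.sub_apply, LinearMap.proj_apply,
      Pi.sub_apply, Pi.single_eq_same, Pi.single_eq_of_ne hab.symm]
    constructor <;> intro h <;> linarith
  rw [hset]
  exact Measure.addHaar_affineSubspace volume s hs

/-- Almost every shock has a unique optimal action. -/
lemma ae_mem_iUnion_optimalSet (v : Fin (J + 1) → ℝ) :
    ∀ᵐ ε : Fin (J + 1) → ℝ, ε ∈ ⋃ a, optimalSet v a := by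
  have h : ∀ᵐ ε : Fin (J + 1) → ℝ, ∀ a b, a ≠ b → ε a - ε b ≠ v b - v a := by
    refine ae_all_iff.2 fun a => ae_all_iff.2 fun b => ?_
    by_cases hab : a = b
    · simp [hab]
    · filter_upwards [measure_eq_zero_iff_ae_notMem.1 (volume_setOf_sub_eq hab (v b - v a))] with ε hε
      exact fun _ => hε
  filter_upwards [h] with ε hε
  obtain ⟨a, ha⟩ := Finite.exists_max fun b => v b + ε b
  refine Set.mem_iUnion.2 ⟨a, fun b hb => lt_of_le_of_ne (ha b) fun heq => hε b a hb ?_⟩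
  linarith

lemma integral_eq_sum_optimalSet (v : Fin (J + 1) → ℝ) {h : (Fin (J + 1) → ℝ) → ℝ}
    (hh : Integrable h) : ∫ ε, h ε = ∑ a, ∫ ε in optimalSet v a, h ε := by
  rw [← integral_iUnion_fintype (fun a => (isOpen_optimalSet v a).measurableSet)
    (pairwise_disjoint_optimalSet v) (fun a => hh.integrableOn), Measure.restrict_eq_self_of_ae_mem
    (ae_mem_iUnion_optimalSet v)]

lemma le_iSup_add (w ε : Fin (J + 1) → ℝ) (a : Fin (J + 1)) : w a + ε a ≤ ⨆ b, (w b + ε b) :=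
  le_ciSup (f := fun b => w b + ε b) (Set.finite_range _).bddAbove a

lemma iSup_add_of_mem_optimalSet {v ε : Fin (J + 1) → ℝ} {a : Fin (J + 1)}
    (h : ε ∈ optimalSet v a) : ⨆ b, (v b + ε b) = v a + ε a := by
  refine le_antisymm (ciSup_le fun b => ?_) (le_iSup_add v ε a)
  by_cases hb : b = a
  · rw [hb]
  · exact (h b hb).le

end Ties

namespace Model

variable {dα df J S : ℕ} {M : Model dα df J S}

/-- The expected value of the maximum of `v a + ε a` over the actions `a`. -/
noncomputable def surplus (M : Model dα df J S) (α : Vec dα) (x : Fin S) (v : Fin (J + 1) → ℝ) :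
    ℝ :=
  ∫ ε, (⨆ a, (v a + ε a)) * M.g α x ε

/-! ### The expected maximum and its subgradient -/

section Surplus

variable (hreg : M.Regular) {α : Vec dα} (hα : α ∈ M.Θα) (x : Fin S)
include hreg hα

lemma Regular.integrable_apply_mul (a : Fin (J + 1)) : Integrable fun ε => ε a * M.g α x ε := by
  refine (hreg.finite_moment α hα x).mono
    ((measurable_pi_apply a).aestronglyMeasurable.mul (M.g_integrable α hα x).1)
    (Eventually.of_forall fun ε => ?_)
  rw [norm_mul, norm_mul, norm_norm]
  gcongr
  exact norm_le_pi_norm ε a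

lemma Regular.integrable_add_apply_mul (w : ℝ) (a : Fin (J + 1)) :
    Integrable fun ε => (w + ε a) * M.g α x ε := by
  simp only [add_mul]
  exact ((M.g_integrable α hα x).const_mul w).add (hreg.integrable_apply_mul hα x a)

lemma Regular.integrable_iSup_mul (v : Fin (J + 1) → ℝ) :
    Integrable fun ε => (⨆ a, (v a + ε a)) * M.g α x ε := by
  refine (integrable_finsetSum Finset.univ fun a _ =>
    (hreg.integrable_add_apply_mul hα x (v a) a).norm).mono
    ((Measurable.iSup fun a => by fun_prop).aestronglyMeasurable.mul (M.g_integrable α hα x).1)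
    (Eventually.of_forall fun ε => ?_)
  obtain ⟨b, hb⟩ := exists_eq_ciSup_of_finite (f := fun a => v a + ε a)
  rw [← hb, Real.norm_of_nonneg (Finset.sum_nonneg fun _ _ => norm_nonneg _)]
  exact Finset.single_le_sum (f := fun a => ‖(v a + ε a) * M.g α x ε‖)
    (fun _ _ => norm_nonneg _) (Finset.mem_univ b)

lemma Regular.setIntegral_add_apply_mul (v : Fin (J + 1) → ℝ) (w : ℝ) (a : Fin (J + 1)) :
    ∫ ε in optimalSet v a, (w + ε a) * M.g α x ε =
      w * M.choiceProb α x v a + ∫ ε in optimalSet v a, ε a * M.g α x ε := by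
  simp only [add_mul]
  rw [integral_add ((M.g_integrable α hα x).const_mul w).integrableOn
    (hreg.integrable_apply_mul hα x a).integrableOn, integral_const_mul]
  rfl

lemma Regular.surplus_eq (v : Fin (J + 1) → ℝ) : M.surplus α x v =
    ∑ a, (v a * M.choiceProb α x v a + ∫ ε in optimalSet v a, ε a * M.g α x ε) := by
  rw [surplus, integral_eq_sum_optimalSet v (hreg.integrable_iSup_mul hα x v)]
  refine Finset.sum_congr rfl fun a _ => ?_
  rw [← hreg.setIntegral_add_apply_mul hα]
  refine setIntegral_congr_fun (isOpen_optimalSet v a).measurableSet fun ε hε => ?_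
  simp only [iSup_add_of_mem_optimalSet hε]

/-- The left side is the payoff, at values `w`, of the decision rule that is optimal for `v`; no
rule beats the pointwise maximum. With equality at `w = v`, this is the subgradient inequality. -/
lemma Regular.le_surplus (v w : Fin (J + 1) → ℝ) :
    ∑ a, (w a * M.choiceProb α x v a + ∫ ε in optimalSet v a, ε a * M.g α x ε) ≤
      M.surplus α x w := by
  rw [surplus, integral_eq_sum_optimalSet v (hreg.integrable_iSup_mul hα x w)]
  refine Finset.sum_le_sum fun a _ => ?_
  rw [← hreg.setIntegral_add_apply_mul hα]
  refine setIntegral_mono (hreg.integrable_add_apply_mul hα x (w a) a).integrableOn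
    (hreg.integrable_iSup_mul hα x w).integrableOn fun ε => ?_
  exact mul_le_mul_of_nonneg_right (le_iSup_add w ε a) (M.g_nonneg α hα x ε)

omit hreg in
lemma sum_choiceProb (v : Fin (J + 1) → ℝ) : ∑ a, M.choiceProb α x v a = 1 := by
  rw [← M.g_integral α hα x, integral_eq_sum_optimalSet v (M.g_integrable α hα x)]
  rfl

omit hreg in
lemma choiceProb_nonneg (v : Fin (J + 1) → ℝ) (a : Fin (J + 1)) : 0 ≤ M.choiceProb α x v a :=
  integral_nonneg fun ε => M.g_nonneg α hα x ε

/-- Each action is strictly optimal on a nonempty open set of shocks, which full support charges. -/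
lemma Regular.choiceProb_pos (v : Fin (J + 1) → ℝ) (a : Fin (J + 1)) :
    0 < M.choiceProb α x v a := by
  refine lt_of_le_of_ne (choiceProb_nonneg hα x v a) fun h0 => ?_
  have := hreg.full_support α hα x
  refine (isOpen_optimalSet v a).measure_ne_zero
    (volume.withDensity fun ε => ENNReal.ofReal (M.g α x ε)) (optimalSet_nonempty v a) ?_
  rw [withDensity_apply _ (isOpen_optimalSet v a).measurableSet,
    ← ofReal_integral_eq_lintegral_ofReal (M.g_integrable α hα x).integrableOn
      (Eventually.of_forall fun ε => M.g_nonneg α hα x ε)]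
  exact ENNReal.ofReal_eq_zero.2 h0.ge

/-- The subgradient is a probability vector, so the surplus is 1-Lipschitz in the sup norm. This
drives the Bellman contraction. -/
lemma Regular.surplus_sub_le (v w : Fin (J + 1) → ℝ) :
    M.surplus α x v - M.surplus α x w ≤ ‖v - w‖ := by
  have h1 := hreg.le_surplus hα x v w
  rw [hreg.surplus_eq hα x v]
  have h2 : ∑ a, (v a - w a) * M.choiceProb α x v a ≤ ∑ a, ‖v - w‖ * M.choiceProb α x v a := by
    refine Finset.sum_le_sum fun a _ =>
      mul_le_mul_of_nonneg_right ?_ (choiceProb_nonneg hα x v a)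
    exact (le_abs_self _).trans (norm_le_pi_norm (v - w) a)
  rw [← Finset.mul_sum, sum_choiceProb hα, mul_one] at h2
  simp only [sub_mul, Finset.sum_add_distrib, Finset.sum_sub_distrib] at h1 h2 ⊢
  linarith

/-- The conjugate of the surplus at the choice probabilities does not depend on the values that
generate them. -/
lemma Regular.sum_setIntegral_eq {v w : Fin (J + 1) → ℝ}
    (h : ∀ a, M.choiceProb α x w a = M.choiceProb α x v a) :
    ∑ a, ∫ ε in optimalSet w a, ε a * M.g α x ε = ∑ a, ∫ ε in optimalSet v a, ε a * M.g α x ε := by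
  -- The subgradient inequality is used in both directions: with equal choice probabilities the
  -- linear terms cancel, leaving two opposite inequalities.
  have h1 := hreg.le_surplus hα x v w
  have h2 := hreg.le_surplus hα x w v
  rw [hreg.surplus_eq hα] at h1 h2
  simp only [h, Finset.sum_add_distrib] at h1 h2
  linarith

end Surplus

/-! ### The Bellman equation and the fixed point of Ψ -/

section Bellman

variable (hreg : M.Regular) {α : Vec dα} (hα : α ∈ M.Θα) {τ : Vec df} (hτ : τ ∈ M.Θf)
include hτ

lemma norm_choiceValue_sub_le (V W : Fin S → ℝ) (x : Fin S) :
    ‖M.choiceValue α τ V x - M.choiceValue α τ W x‖ ≤ M.β * ‖V - W‖ := by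
  refine (pi_norm_le_iff_of_nonneg (mul_nonneg M.β_pos.le (norm_nonneg _))).2 fun a => ?_
  have h1 : (M.choiceValue α τ V x - M.choiceValue α τ W x) a =
      M.β * ∑ x', (V x' - W x') * M.f τ x a x' := by
    simp only [Pi.sub_apply, choiceValue, sub_mul, Finset.sum_sub_distrib]
    ring
  rw [h1, norm_mul, Real.norm_of_nonneg M.β_pos.le]
  refine mul_le_mul_of_nonneg_left ?_ M.β_pos.le
  calc ‖∑ x', (V x' - W x') * M.f τ x a x'‖
      ≤ ∑ x', ‖V - W‖ * M.f τ x a x' := by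
        refine norm_sum_le_of_le _ fun x' _ => ?_
        rw [norm_mul, Real.norm_of_nonneg (M.f_nonneg τ hτ x a x')]
        exact mul_le_mul_of_nonneg_right (norm_le_pi_norm (V - W) x') (M.f_nonneg τ hτ x a x')
    _ = ‖V - W‖ := by rw [← Finset.mul_sum, M.f_sum τ hτ, mul_one]

include hreg hα

/-- The smoothed Bellman equation has a solution. -/
lemma Regular.isSmoothedValue_value : M.IsSmoothedValue α τ (M.value α τ) := by
  have hT : ContractingWith ⟨M.β, M.β_pos.le⟩
      fun (V : Fin S → ℝ) x => M.surplus α x (M.choiceValue α τ V x) := by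
    refine ⟨by exact_mod_cast M.β_lt_one, LipschitzWith.of_dist_le_mul fun V W => ?_⟩
    rw [dist_eq_norm, dist_eq_norm]
    refine (pi_norm_le_iff_of_nonneg (mul_nonneg M.β_pos.le (norm_nonneg _))).2 fun x => ?_
    rw [Pi.sub_apply, Real.norm_eq_abs, abs_le']
    refine ⟨(hreg.surplus_sub_le hα x _ _).trans (norm_choiceValue_sub_le hτ V W x), ?_⟩
    rw [neg_sub, norm_sub_rev]
    exact (hreg.surplus_sub_le hα x _ _).trans (norm_choiceValue_sub_le hτ W V x)
  exact Classical.epsilon_spec ⟨_, fun x => (congrFun hT.fixedPoint_isFixedPt x).symm⟩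

omit hτ hreg in
lemma fullCCP_Lam (V : Fin S → ℝ) (x : Fin S) (a : Fin (J + 1)) :
    fullCCP (M.Lam α τ V) x a = M.choiceProb α x (M.choiceValue α τ V x) a := by
  refine Fin.lastCases ?_ (fun b => ?_) a
  · have h := sum_choiceProb hα x (M.choiceValue α τ V x)
    rw [Fin.sum_univ_castSucc] at h
    simp only [fullCCP, Fin.snoc_last, Lam]
    linarith
  · simp [fullCCP, Lam]

omit hτ in
lemma Regular.Lam_mem_ccpSpace (V : Fin S → ℝ) : M.Lam α τ V ∈ ccpSpace J S := fun x a => by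
  rw [fullCCP_Lam hα]
  exact hreg.choiceProb_pos hα x _ a

omit hτ in
-- This links φ to the Bellman equation: when V solves it, the surplus on the right is V(x) and the
-- identity is a linear system in V. Injectivity of the map from values to probabilities is not
-- needed, because only the sum of the shock integrals enters.
lemma Regular.flowPayoff_Lam (V : Fin S → ℝ) (x : Fin S) :
    M.flowPayoff α (M.Lam α τ V) x =
      M.surplus α x (M.choiceValue α τ V x) -
        ∑ a, fullCCP (M.Lam α τ V) x a * (M.β * ∑ x', V x' * M.f τ x a x') := by
  set v := M.choiceValue α τ V x with hv
  have hp : fullCCP (M.Lam α τ V) x = M.choiceProb α x v := funext fun a => fullCCP_Lam hα V x a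
  -- `Classical.epsilon` is meaningful only if some vector qualifies; `v` shifted to vanish at the
  -- last action does, as a common shift leaves the optimal sets unchanged.
  obtain ⟨-, hw⟩ : M.normalizedValue α x (M.choiceProb α x v) (Fin.last J) = 0 ∧
      ∀ a, M.choiceProb α x (M.normalizedValue α x (M.choiceProb α x v)) a =
        M.choiceProb α x v a := by
    refine Classical.epsilon_spec
      (p := fun w : Fin (J + 1) → ℝ => w (Fin.last J) = 0 ∧
        ∀ a, M.choiceProb α x w a = M.choiceProb α x v a)
      ⟨fun b => v b + -v (Fin.last J), by simp, fun a => ?_⟩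
    rw [choiceProb, optimalSet_add_const]
    rfl
  rw [flowPayoff, hp, hreg.surplus_eq hα, Finset.sum_add_distrib,
    ← hreg.sum_setIntegral_eq hα x hw, ← Finset.sum_add_distrib, ← Finset.sum_sub_distrib]
  refine Finset.sum_congr rfl fun a _ => ?_
  rw [meanShock, hw a, mul_add, mul_div_cancel₀ _ (hreg.choiceProb_pos hα x v a).ne']
  simp only [hv, choiceValue]
  ring

omit hreg hα in
-- The state matrix is stochastic and β < 1, so the matrix is strictly diagonally dominant by rows:
-- β(1 - F(x,x)) < 1 - βF(x,x).
lemma det_one_sub_stateMatrix_ne_zero {P : CCPVec J S} (hP : P ∈ ccpSpace J S) :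
    (1 - M.β • M.stateMatrix τ P).det ≠ 0 := by
  have hF0 : ∀ x x', 0 ≤ M.stateMatrix τ P x x' := fun x x' => by
    rw [stateMatrix, Matrix.of_apply]
    exact Finset.sum_nonneg fun a _ => mul_nonneg (hP x a).le (M.f_nonneg τ hτ x a x')
  have hF1 : ∀ x, ∑ x', M.stateMatrix τ P x x' = 1 := fun x => by
    simp only [stateMatrix, Matrix.of_apply]
    rw [Finset.sum_comm]
    simp only [← Finset.mul_sum, M.f_sum τ hτ, mul_one]
    simp [fullCCP, Fin.sum_univ_castSucc]
  have hβ := M.β_pos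
  refine det_ne_zero_of_sum_row_lt_diag fun x => ?_
  have h1 : ∀ x' ∈ Finset.univ.erase x,
      ‖(1 - M.β • M.stateMatrix τ P) x x'‖ = M.β * M.stateMatrix τ P x x' := fun x' hx' => by
    rw [Matrix.sub_apply, Matrix.one_apply_ne (Finset.ne_of_mem_erase hx').symm, zero_sub, norm_neg,
      Matrix.smul_apply, smul_eq_mul, Real.norm_of_nonneg (mul_nonneg hβ.le (hF0 x x'))]
  have h2 : M.stateMatrix τ P x x ≤ 1 :=
    (hF1 x) ▸ Finset.single_le_sum (fun x' _ => hF0 x x') (Finset.mem_univ x)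
  rw [Finset.sum_congr rfl h1, ← Finset.mul_sum, Matrix.sub_apply, Matrix.one_apply_eq,
    Matrix.smul_apply, smul_eq_mul]
  have h3 := Finset.add_sum_erase Finset.univ (M.stateMatrix τ P x) (Finset.mem_univ x)
  rw [hF1 x] at h3
  refine lt_of_lt_of_le ?_ (le_abs_self _)
  have h4 : ∑ x' ∈ Finset.univ.erase x, M.stateMatrix τ P x x' = 1 - M.stateMatrix τ P x x := by
    linarith
  rw [h4]
  linarith [M.β_lt_one]

/-- The model-implied CCPs are a fixed point of the policy function mapping. -/
lemma Regular.Psi_ccp : M.Psi α τ (M.ccp α τ) = M.ccp α τ := by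
  have hV := hreg.isSmoothedValue_value hα hτ
  have hphi : M.phi α τ (M.ccp α τ) = M.value α τ := by
    have hdet : IsUnit (1 - M.β • M.stateMatrix τ (M.ccp α τ)).det :=
      isUnit_iff_ne_zero.2 (det_one_sub_stateMatrix_ne_zero hτ (hreg.Lam_mem_ccpSpace hα _))
    have hflow : M.flowPayoff α (M.ccp α τ) =
        (1 - M.β • M.stateMatrix τ (M.ccp α τ)).mulVec (M.value α τ) := by
      funext x
      have hx : M.value α τ x = M.surplus α x (M.choiceValue α τ (M.value α τ) x) := hV x
      rw [ccp, hreg.flowPayoff_Lam hα, ← hx, Matrix.sub_mulVec, Matrix.one_mulVec, Pi.sub_apply,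
        Matrix.smul_mulVec, Pi.smul_apply, smul_eq_mul, Matrix.mulVec, dotProduct]
      simp only [stateMatrix, Matrix.of_apply, Finset.sum_mul, Finset.mul_sum]
      rw [Finset.sum_comm]
      refine congrArg _ (Finset.sum_congr rfl fun _ _ => Finset.sum_congr rfl fun _ _ => ?_)
      ring
    rw [phi, hflow, Matrix.mulVec_mulVec, Matrix.nonsing_inv_mul _ hdet, Matrix.one_mulVec]
  rw [Psi, hphi, ccp]

end Bellman

end Model

lemma isOpen_ccpSpace (J S : ℕ) : IsOpen (ccpSpace J S) := by
  have : ccpSpace J S = ⋂ x, ⋂ a, {P | 0 < fullCCP P x a} := by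
    ext P; simp [ccpSpace]
  rw [this]
  refine isOpen_iInter_of_finite fun x => isOpen_iInter_of_finite fun a =>
    isOpen_lt continuous_const ?_
  refine Fin.lastCases ?_ (fun b => ?_) a
  · simp only [fullCCP, Fin.snoc_last]; fun_prop
  · simp only [fullCCP, Fin.snoc_castSucc]; fun_prop

end DDC

namespace DDC

/-! ### Deterministic estimates -/

/-- Near-maximality of well-separated maxima: maximizers of functions uniformly close to `q` are
close to the unique maximizer of `q`. -/
lemma exists_pos_forall_argmax_dist_lt {E : Type*} [MetricSpace E] {Θ : Set E} (hΘ : IsCompact Θ)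
    {q : E → ℝ} {a₀ : E} (ha₀ : a₀ ∈ Θ) (husc : UpperSemicontinuousOn q Θ)
    (hmax : ∀ a ∈ Θ, a ≠ a₀ → q a < q a₀) {η : ℝ} (hη : 0 < η) :
    ∃ c : ℝ, 0 < c ∧ ∀ f : E → ℝ, (∀ a ∈ Θ, ‖f a - q a‖ < c) →
      ∀ a ∈ Θ, (∀ a' ∈ Θ, f a' ≤ f a) → dist a a₀ < η := by
  have hcomp : IsCompact (Θ \ Metric.ball a₀ η) := hΘ.diff Metric.isOpen_ball
  rcases (Θ \ Metric.ball a₀ η).eq_empty_or_nonempty with hemp | hne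
  · refine ⟨1, one_pos, fun f _ a ha _ => ?_⟩
    by_contra hd
    have : a ∈ Θ \ Metric.ball a₀ η := ⟨ha, hd⟩
    rw [hemp] at this
    exact this
  · obtain ⟨b, hb, hbmax⟩ := (husc.mono Set.sdiff_subset).exists_isMaxOn hne hcomp
    have hba : b ≠ a₀ := fun h => hb.2 (by rw [h]; exact Metric.mem_ball_self hη)
    have hlt := hmax b hb.1 hba
    -- With an error below half the gap, no point outside the ball can do as well as `a₀`.
    refine ⟨(q a₀ - q b) / 2, by linarith, fun f hf a ha hfa => ?_⟩
    by_contra hd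
    have h1 : q a ≤ q b := hbmax (show a ∈ Θ \ Metric.ball a₀ η from ⟨ha, hd⟩)
    have h2 := abs_lt.1 (hf a ha)
    have h3 := abs_lt.1 (hf a₀ ha₀)
    have h4 := hfa a₀ ha₀
    linarith [h2.2, h3.1]

/-- Solving a perturbed linear equation `s + H d + u ≈ 0` for `d`. -/
lemma norm_add_inverse_apply_le {E : Type*} [NormedAddCommGroup E] [NormedSpace ℝ E]
    {H : E →L[ℝ] E} (hH : H.IsInvertible) {d v : E} {e z g : ℝ} (he : 0 ≤ e)
    (heH : ‖H.inverse‖ * e ≤ 1 / 2) (hv : ‖v‖ ≤ g * z)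
    (h : ‖H d + v‖ ≤ e * (‖d‖ + 2 * z)) :
    ‖d + H.inverse v‖ ≤ e * (2 * ‖H.inverse‖ * (‖H.inverse‖ * g + 2)) * z := by
  set Hi := H.inverse
  have h0 : d + Hi v = Hi (H d + v) := by
    obtain ⟨L, rfl⟩ := hH
    simp [Hi]
  have h1 : ‖d + Hi v‖ ≤ ‖Hi‖ * (e * (‖d‖ + 2 * z)) := by
    rw [h0]
    exact (Hi.le_opNorm _).trans (by gcongr)
  have h2 : ‖d‖ ≤ ‖d + Hi v‖ + ‖Hi‖ * (g * z) := by
    have h3 : ‖Hi v‖ ≤ ‖Hi‖ * (g * z) := (Hi.le_opNorm _).trans (by gcongr)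
    have h4 : ‖d‖ ≤ ‖d + Hi v‖ + ‖Hi v‖ := by
      simpa using norm_sub_le (d + Hi v) (Hi v)
    linarith
  -- The error proportional to `‖d‖` is absorbed on the left at the cost of one half, hence the
  -- factor 2 in the bound.
  have h5 : ‖Hi‖ * e * ‖d + Hi v‖ ≤ 1 / 2 * ‖d + Hi v‖ :=
    mul_le_mul_of_nonneg_right heH (norm_nonneg _)
  have h6 : ‖Hi‖ * e * ‖d‖ ≤ ‖Hi‖ * e * (‖d + Hi v‖ + ‖Hi‖ * (g * z)) := by gcongr
  nlinarith [h1, h5, h6]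

namespace Criterion

variable {dα df J S : ℕ} {Q : Criterion dα df J S}

/-- First-order condition. -/
lemma dA_eq_zero_of_isMax {Θ : Set (Vec dα)} {a : Vec dα} {t : Vec df} {P : CCPVec J S}
    (ha : a ∈ interior Θ) (hmax : ∀ a' ∈ Θ, Q a' t P ≤ Q a t P) : Q.dA a t P = 0 := by
  have hloc : IsLocalMax (fun a' => Q a' t P) a := by
    filter_upwards [mem_interior_iff_mem_nhds.1 ha] with a' ha'
    exact hmax a' ha'
  rw [dA, gradient, hloc.fderiv_eq_zero, map_zero]

/-- First-order expansion of the score when its partial derivatives are almost constant. -/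
lemma norm_dA_sub_le {a₀ : Vec dα} {t₀ : Vec df} {P₀ : CCPVec J S} {r e : ℝ}
    {H : Vec dα →L[ℝ] Vec dα} {G : Vec df →L[ℝ] Vec dα} {L : CCPVec J S →L[ℝ] Vec dα}
    (hQ : ∀ y ∈ Metric.ball (a₀, t₀, P₀) r, Q.HasPartials y.1 y.2.1 y.2.2 ∧
      ‖Q.dAA y.1 y.2.1 y.2.2 - H‖ ≤ e ∧ ‖Q.dAF y.1 y.2.1 y.2.2 - G‖ ≤ e ∧
      ‖Q.dAP y.1 y.2.1 y.2.2 - L‖ ≤ e)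
    {a : Vec dα} {t : Vec df} {P : CCPVec J S} (hy : (a, t, P) ∈ Metric.ball (a₀, t₀, P₀) r) :
    ‖Q.dA a t P - Q.dA a₀ t₀ P₀ - (H (a - a₀) + G (t - t₀) + L (P - P₀))‖ ≤
      e * (‖a - a₀‖ + ‖t - t₀‖ + ‖P - P₀‖) := by
  have hball : ∀ {b t' P'}, b ∈ Metric.ball a₀ r → t' ∈ Metric.ball t₀ r → P' ∈ Metric.ball P₀ r →
      (b, t', P') ∈ Metric.ball (a₀, t₀, P₀) r := fun hb ht' hP' => by
    rw [← ball_prod_same, ← ball_prod_same]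
    exact ⟨hb, ht', hP'⟩
  rw [← ball_prod_same, ← ball_prod_same] at hy
  obtain ⟨ha, ht, hP⟩ : a ∈ Metric.ball a₀ r ∧ t ∈ Metric.ball t₀ r ∧ P ∈ Metric.ball P₀ r := hy
  have hr : 0 < r := Metric.pos_of_mem_ball ha
  have h0 := Metric.mem_ball_self (x := a₀) hr
  have h1 := Metric.mem_ball_self (x := t₀) hr
  -- The mean value inequality is applied to one block of variables at a time. A ball for the
  -- product metric is a product of balls, so every intermediate point stays inside.
  have hA : ‖Q.dA a t P - Q.dA a₀ t P - H (a - a₀)‖ ≤ e * ‖a - a₀‖ :=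
    (convex_ball a₀ r).norm_image_sub_le_of_norm_fderiv_le' (𝕜 := ℝ) (f := fun b => Q.dA b t P)
      (fun b hb => (hQ _ (hball hb ht hP)).1.dAA) (fun b hb => (hQ _ (hball hb ht hP)).2.1) h0 ha
  have hF : ‖Q.dA a₀ t P - Q.dA a₀ t₀ P - G (t - t₀)‖ ≤ e * ‖t - t₀‖ :=
    (convex_ball t₀ r).norm_image_sub_le_of_norm_fderiv_le' (𝕜 := ℝ) (f := fun b => Q.dA a₀ b P)
      (fun b hb => (hQ _ (hball h0 hb hP)).1.dAF) (fun b hb => (hQ _ (hball h0 hb hP)).2.2.1) h1 ht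
  have hL : ‖Q.dA a₀ t₀ P - Q.dA a₀ t₀ P₀ - L (P - P₀)‖ ≤ e * ‖P - P₀‖ :=
    (convex_ball P₀ r).norm_image_sub_le_of_norm_fderiv_le' (𝕜 := ℝ) (f := fun b => Q.dA a₀ t₀ b)
      (fun b hb => (hQ _ (hball h0 h1 hb)).1.dAP) (fun b hb => (hQ _ (hball h0 h1 hb)).2.2.2)
      (Metric.mem_ball_self hr) hP
  calc ‖Q.dA a t P - Q.dA a₀ t₀ P₀ - (H (a - a₀) + G (t - t₀) + L (P - P₀))‖
      = ‖(Q.dA a t P - Q.dA a₀ t P - H (a - a₀)) + (Q.dA a₀ t P - Q.dA a₀ t₀ P - G (t - t₀)) +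
          (Q.dA a₀ t₀ P - Q.dA a₀ t₀ P₀ - L (P - P₀))‖ := by congr 1; abel
    _ ≤ e * ‖a - a₀‖ + e * ‖t - t₀‖ + e * ‖P - P₀‖ :=
        norm_add₃_le.trans (add_le_add (add_le_add hA hF) hL)
    _ = e * (‖a - a₀‖ + ‖t - t₀‖ + ‖P - P₀‖) := by ring

end Criterion

/-! ### Stochastic limits -/

section Uniform

variable {Ω : ℕ → Type*} [∀ n, MeasurableSpace (Ω n)] {μ : ∀ n, Measure (Ω n)}
  [∀ n, IsProbabilityMeasure (μ n)]

omit [∀ n, IsProbabilityMeasure (μ n)] in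
lemma wpa1_forall_norm_sub_lt {Y E : Type*} [NormedAddCommGroup E] {N : Set Y}
    {F : ∀ n, Ω n → Y → E} {F₀ : Y → E}
    (h : IsLittleOp μ fun n ω => ⨆ y ∈ N, ‖F n ω y - F₀ y‖ₑ) {η : ℝ} (hη : 0 < η) :
    WPA1 μ fun n ω => ∀ y ∈ N, ‖F n ω y - F₀ y‖ < η := by
  refine (h.wpa1_lt (ENNReal.ofReal_pos.2 hη)).mono (Eventually.of_forall fun n ω hω y hy => ?_)
  have h1 := (le_iSup₂ (f := fun y (_ : y ∈ N) => ‖F n ω y - F₀ y‖ₑ) y hy).trans_lt hω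
  rwa [← ofReal_norm, ENNReal.ofReal_lt_ofReal_iff hη] at h1

/-- Uniform limits in probability of continuous functions are continuous, and the approximating
functions are almost constant near every point. -/
lemma exists_ball_wpa1_norm_sub_le {Y E : Type*} [MetricSpace Y] [NormedAddCommGroup E] {N : Set Y}
    {y₀ : Y} (hN : N ∈ 𝓝 y₀) {F : ∀ n, Ω n → Y → E} {F₀ : Y → E}
    (hc : WPA1 μ fun n ω => ContinuousOn (F n ω) N)
    (h : IsLittleOp μ fun n ω => ⨆ y ∈ N, ‖F n ω y - F₀ y‖ₑ) {e : ℝ} (he : 0 < e) :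
    ∃ r > 0, WPA1 μ fun n ω => ∀ y ∈ Metric.ball y₀ r, ‖F n ω y - F₀ y₀‖ ≤ e := by
  have hcont : ContinuousOn F₀ N := by
    refine continuousOn_of_uniform_approx_of_continuousOn fun u hu => ?_
    obtain ⟨η, hη, hηu⟩ := Metric.mem_uniformity_dist.1 hu
    -- The limit is not random, so a single outcome with a continuous, η-close approximant suffices;
    -- one exists because its probability tends to one.
    obtain ⟨n, ω, h1, h2⟩ := (hc.and (wpa1_forall_norm_sub_lt h hη)).exists
    refine ⟨F n ω, h1, fun y hy => hηu ?_⟩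
    rw [dist_comm, dist_eq_norm]
    exact h2 y hy
  have hev := Metric.eventually_nhds_iff_ball.1
    (Filter.Eventually.and hN (Metric.tendsto_nhds.1 (hcont.continuousAt hN) (e / 2) (half_pos he)))
  obtain ⟨r, hr, hball⟩ := hev
  refine ⟨r, hr, (wpa1_forall_norm_sub_lt h (half_pos he)).mono
    (Eventually.of_forall fun n ω hω y hy => ?_)⟩
  have h1 := hω y (hball y hy).1
  have h2 := (hball y hy).2
  rw [dist_eq_norm] at h2
  calc ‖F n ω y - F₀ y₀‖ = ‖(F n ω y - F₀ y) + (F₀ y - F₀ y₀)‖ := by congr 1; abel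
    _ ≤ e / 2 + e / 2 := norm_add_le_of_le h1.le h2.le
    _ = e := add_halves e

end Uniform

lemma tendsto_rate_atTop {δ : ℝ} (hδ : 0 < δ) : Tendsto (rate δ) atTop atTop :=
  (tendsto_rpow_atTop (lt_min one_half_pos hδ)).comp tendsto_natCast_atTop_atTop

/-! ### Consistency and linearization of one stage -/

namespace CriterionConditions

variable {dα df J S : ℕ} {M : Model dα df J S} {Ω : ℕ → Type*} [∀ n, MeasurableSpace (Ω n)]
  {μ : ∀ n, Measure (Ω n)} [∀ n, IsProbabilityMeasure (μ n)]
  {Q : ∀ n, Ω n → Criterion dα df J S} {Qinf : Criterion dα df J S}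
  {N : Set (Vec dα × Vec df × CCPVec J S)} {τhat : ∀ n, Ω n → Vec df}
  {αs : Vec dα} {τs : Vec df} {Pstar : CCPVec J S}
  (hQ : CriterionConditions M μ Q Qinf τhat N αs τs Pstar)
  {P : ∀ n, Ω n → CCPVec J S} {a : ∀ n, Ω n → Vec dα}
include hQ

omit [∀ n, IsProbabilityMeasure (μ n)] in
/-- Consistency of extremum estimators based on consistent CCP estimators. -/
lemma isLittleOp_argmax_sub (hαs : αs ∈ M.Θα) (hPstar : Pstar ∈ ccpSpace J S)
    (hPm : ∀ n, Measurable (P n)) (hP : IsLittleOp μ fun n ω => ‖P n ω - Pstar‖ₑ)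
    (harg : WPA1 μ fun n ω => a n ω ∈ M.Θα ∧
      ∀ a' ∈ M.Θα, Q n ω a' (τhat n ω) (P n ω) ≤ Q n ω (a n ω) (τhat n ω) (P n ω)) :
    IsLittleOp μ fun n ω => ‖a n ω - αs‖ₑ := by
  classical
  -- Uniform convergence is assumed only along sequences that always lie in the CCP space. Since
  -- that space is open, this modification agrees with `P` with probability approaching one.
  let Ptil : ∀ n, Ω n → CCPVec J S := fun n ω => if P n ω ∈ ccpSpace J S then P n ω else Pstar
  have hPtil : IsLittleOp μ fun n ω => ‖Ptil n ω - Pstar‖ₑ := by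
    rw [isLittleOp_enorm_iff] at hP ⊢
    refine fun η hη => (hP η hη).mono (Eventually.of_forall fun n ω hω => ?_)
    by_cases h : P n ω ∈ ccpSpace J S
    · simpa only [Ptil, if_pos h] using hω
    · simpa only [Ptil, if_neg h, sub_self, norm_zero] using hη
  have hunif := hQ.uniform Ptil
    (fun n => Measurable.ite (hPm n (isOpen_ccpSpace J S).measurableSet) (hPm n) measurable_const)
    (fun n ω => by by_cases h : P n ω ∈ ccpSpace J S <;> simp [Ptil, h, hPstar]) hPtil
  obtain ⟨ρ, hρ, hball⟩ := Metric.isOpen_iff.1 (isOpen_ccpSpace J S) Pstar hPstar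
  rw [isLittleOp_enorm_iff]
  intro η hη
  obtain ⟨c, hc, hc'⟩ := exists_pos_forall_argmax_dist_lt M.compact_Θα hαs hQ.usc hQ.unique_max hη
  refine (((wpa1_forall_norm_sub_lt (F := fun n ω a' => Q n ω a' (τhat n ω) (Ptil n ω))
    (F₀ := fun a' => Qinf a' τs Pstar) hunif hc).and harg).and (isLittleOp_enorm_iff.1 hP ρ hρ)).mono
    (Eventually.of_forall ?_)
  rintro n ω ⟨⟨h1, h2, h3⟩, h4⟩
  have h5 : Ptil n ω = P n ω := if_pos (hball (by rwa [Metric.mem_ball, dist_eq_norm]))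
  rw [h5] at h1
  rw [← dist_eq_norm]
  exact hc' _ h1 _ h2 h3

/-- Linearization of one stage of the algorithm. -/
lemma wpa1_norm_linearization_le (hint : αs ∈ interior M.Θα)
    (ha : IsLittleOp μ fun n ω => ‖a n ω - αs‖ₑ)
    (hτ : IsLittleOp μ fun n ω => ‖τhat n ω - τs‖ₑ)
    (hP : IsLittleOp μ fun n ω => ‖P n ω - Pstar‖ₑ)
    (harg : WPA1 μ fun n ω =>
      ∀ a' ∈ M.Θα, Q n ω a' (τhat n ω) (P n ω) ≤ Q n ω (a n ω) (τhat n ω) (P n ω))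
    {e : ℝ} (he : 0 < e) :
    WPA1 μ fun n ω =>
      ‖(a n ω - αs) + (Qinf.dAA αs τs Pstar).inverse
        ((Q n ω).dA αs τs Pstar + Qinf.dAF αs τs Pstar (τhat n ω - τs))‖ ≤
      e * ‖(((Q n ω).dA αs τs Pstar, τhat n ω - τs), P n ω - Pstar)‖ := by
  set H := Qinf.dAA αs τs Pstar
  set G := Qinf.dAF αs τs Pstar
  set c := 2 * ‖H.inverse‖ * (‖H.inverse‖ * (1 + ‖G‖) + 2)
  have hc : 0 ≤ c := by positivity
  -- The first bound permits the absorption in `norm_add_inverse_apply_le`; the second turns its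
  -- constant `c`, taken at `g = 1 + ‖G‖`, into the prescribed `e`.
  set e' := min (1 / (2 * (‖H.inverse‖ + 1))) (e / (c + 1))
  have he' : 0 < e' := lt_min (by positivity) (by positivity)
  have he'H : ‖H.inverse‖ * e' ≤ 1 / 2 := by
    calc ‖H.inverse‖ * e' ≤ (‖H.inverse‖ + 1) * (1 / (2 * (‖H.inverse‖ + 1))) := by
          gcongr
          · linarith
          · exact min_le_left _ _
      _ = 1 / 2 := by field_simp
  have he'c : e' * c ≤ e := by
    calc e' * c ≤ e / (c + 1) * (c + 1) := by
          gcongr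
          · exact min_le_right _ _
          · linarith
      _ = e := by field_simp
  obtain ⟨r₁, hr₁, h₁⟩ := exists_ball_wpa1_norm_sub_le hQ.nhds
    (hQ.smooth.mono (Eventually.of_forall fun n ω h => h.cont_AA)) hQ.conv_AA he'
  obtain ⟨r₂, hr₂, h₂⟩ := exists_ball_wpa1_norm_sub_le hQ.nhds
    (hQ.smooth.mono (Eventually.of_forall fun n ω h => h.cont_AF)) hQ.conv_AF he'
  obtain ⟨r₃, hr₃, h₃⟩ := exists_ball_wpa1_norm_sub_le hQ.nhds
    (hQ.smooth.mono (Eventually.of_forall fun n ω h => h.cont_AP)) hQ.conv_AP he'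
  obtain ⟨r₄, hr₄, h₄⟩ := Metric.mem_nhds_iff.1 hQ.nhds
  obtain ⟨r₅, hr₅, h₅⟩ := Metric.mem_nhds_iff.1 (isOpen_interior.mem_nhds hint)
  obtain ⟨r, hr0, hr⟩ : ∃ r > 0, r ≤ r₁ ∧ r ≤ r₂ ∧ r ≤ r₃ ∧ r ≤ r₄ ∧ r ≤ r₅ :=
    ⟨min r₁ (min r₂ (min r₃ (min r₄ r₅))), by positivity, by simp⟩
  obtain ⟨hr1, hr2, hr3, hr4, hr5⟩ := hr
  refine (((((h₁.and h₂).and h₃).and (hQ.smooth.and harg)).and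
    (isLittleOp_enorm_iff.1 ha r hr0)).and ((isLittleOp_enorm_iff.1 hτ r hr0).and
    (isLittleOp_enorm_iff.1 hP r hr0))).mono (Eventually.of_forall ?_)
  rintro n ω ⟨⟨⟨⟨⟨hAA, hAF⟩, hAP⟩, hsm, hmax⟩, hda⟩, hdt, hdP⟩
  have hfoc : (Q n ω).dA (a n ω) (τhat n ω) (P n ω) = 0 :=
    Criterion.dA_eq_zero_of_isMax
      (h₅ (Metric.mem_ball.2 (by rw [dist_eq_norm]; exact hda.trans_le hr5))) hmax
  have hy : (a n ω, τhat n ω, P n ω) ∈ Metric.ball (αs, τs, Pstar) r := by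
    simp only [← ball_prod_same, Set.mem_prod, Metric.mem_ball, dist_eq_norm]
    exact ⟨hda, hdt, hdP⟩
  have hexp := Criterion.norm_dA_sub_le (Q := Q n ω) (H := H) (G := G)
    (L := Qinf.dAP αs τs Pstar) (fun y hy => ⟨hsm.exist y (h₄ (Metric.ball_subset_ball hr4 hy)),
      hAA y (Metric.ball_subset_ball hr1 hy), hAF y (Metric.ball_subset_ball hr2 hy),
      hAP y (Metric.ball_subset_ball hr3 hy)⟩) hy
  set s := (Q n ω).dA αs τs Pstar
  set z := ‖((s, τhat n ω - τs), P n ω - Pstar)‖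
  have hzP : ‖P n ω - Pstar‖ ≤ z := norm_snd_le ((s, τhat n ω - τs), P n ω - Pstar)
  have hz1 : ‖(s, τhat n ω - τs)‖ ≤ z := norm_fst_le ((s, τhat n ω - τs), P n ω - Pstar)
  have hzs : ‖s‖ ≤ z := (norm_fst_le (s, τhat n ω - τs)).trans hz1
  have hzt : ‖τhat n ω - τs‖ ≤ z := (norm_snd_le (s, τhat n ω - τs)).trans hz1
  have hv : ‖s + G (τhat n ω - τs)‖ ≤ (1 + ‖G‖) * z := by
    rw [add_mul, one_mul]
    exact norm_add_le_of_le hzs ((G.le_opNorm _).trans (by gcongr))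
  have hlin : ‖H (a n ω - αs) + (s + G (τhat n ω - τs))‖ ≤ e' * (‖a n ω - αs‖ + 2 * z) := by
    -- The score vanishes at the maximizer, and the zero cross derivative removes the linear CCP
    -- term. The CCP error survives only with the small factor `e'`.
    rw [hfoc, hQ.cross_AP, zero_apply, add_zero, zero_sub, ← norm_neg] at hexp
    calc ‖H (a n ω - αs) + (s + G (τhat n ω - τs))‖
        = ‖-(-s - (H (a n ω - αs) + G (τhat n ω - τs)))‖ := by congr 1; abel
      _ ≤ e' * (‖a n ω - αs‖ + ‖τhat n ω - τs‖ + ‖P n ω - Pstar‖) := hexp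
      _ ≤ e' * (‖a n ω - αs‖ + 2 * z) :=
          mul_le_mul_of_nonneg_left (by linarith) he'.le
  refine (norm_add_inverse_apply_le hQ.nonsingular he'.le he'H hv hlin).trans ?_
  exact mul_le_mul_of_nonneg_right he'c (norm_nonneg _)

end CriterionConditions

end DDC

/-! ### Propagation of the rate through the stages -/

namespace DDC

variable {dα df J S : ℕ} {M : Model dα df J S} {Ω : ℕ → Type*} [∀ n, MeasurableSpace (Ω n)]
  {μ : ∀ n, Measure (Ω n)} {τhat : ∀ n, Ω n → Vec df}
  {αs : Vec dα} {τs : Vec df} {Pstar : CCPVec J S}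
  {P : ∀ n, Ω n → CCPVec J S} {a : ∀ n, Ω n → Vec dα}

lemma IsBigOp.prodMk {E F : Type*} [NormedAddCommGroup E] [NormedAddCommGroup F]
    {X : ∀ n, Ω n → E} {Y : ∀ n, Ω n → F} (hX : IsBigOp μ X) (hY : IsBigOp μ Y) :
    IsBigOp μ fun n ω => (X n ω, Y n ω) :=
  hX.of_wpa1_le hY zero_le_one <| WPA1.of_forall fun n ω => by
    rw [Prod.norm_mk, one_mul]
    exact max_le_add_of_nonneg (norm_nonneg _) (norm_nonneg _)

lemma IsBigOp.snd {E F : Type*} [NormedAddCommGroup E] [NormedAddCommGroup F]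
    {X : ∀ n, Ω n → E × F} (hX : IsBigOp μ X) : IsBigOp μ fun n ω => (X n ω).2 :=
  hX.of_wpa1_le hX zero_le_one <| WPA1.of_forall fun n ω => by
    linarith [norm_snd_le (X n ω), norm_nonneg (X n ω)]

/-- One stage of the algorithm: if the CCPs of the previous stage converge at rate `r`, the new
estimator is asymptotically linear and converges at rate `r`. -/
lemma CriterionConditions.isLittleOp_and_isBigOp_stage [∀ n, IsProbabilityMeasure (μ n)]
    {Q : ∀ n, Ω n → Criterion dα df J S} {Qinf : Criterion dα df J S}
    {N : Set (Vec dα × Vec df × CCPVec J S)}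
    (hQ : CriterionConditions M μ Q Qinf τhat N αs τs Pstar)
    (hint : αs ∈ interior M.Θα) (hPstar : Pstar ∈ ccpSpace J S)
    {r : ℕ → ℝ} (hr : Tendsto r atTop atTop)
    (hS : IsBigOp μ fun n ω => r n • ((Q n ω).dA αs τs Pstar, τhat n ω - τs))
    (hPm : ∀ n, Measurable (P n)) (hP : IsBigOp μ fun n ω => r n • (P n ω - Pstar))
    (harg : WPA1 μ fun n ω => a n ω ∈ M.Θα ∧
      ∀ a' ∈ M.Θα, Q n ω a' (τhat n ω) (P n ω) ≤ Q n ω (a n ω) (τhat n ω) (P n ω)) :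
    IsLittleOp μ (fun n ω => ‖r n • (a n ω - αs) -
      -(Qinf.dAA αs τs Pstar).inverse (r n •
        ((Q n ω).dA αs τs Pstar + Qinf.dAF αs τs Pstar (τhat n ω - τs)))‖ₑ) ∧
    IsBigOp μ fun n ω => r n • (a n ω - αs) := by
  have hP0 := hP.isLittleOp_of_smul hr
  have ha0 := hQ.isLittleOp_argmax_sub (interior_subset hint) hPstar hPm hP0 harg
  have hτ0 := IsBigOp.isLittleOp_of_smul hr (X := fun n ω => τhat n ω - τs) hS.snd
  have hZ := hS.prodMk hP
  have hlin := fun e he => hQ.wpa1_norm_linearization_le hint ha0 hτ0 hP0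
    (harg.mono (Eventually.of_forall fun n ω h => h.2)) (e := e) he
  set H := Qinf.dAA αs τs Pstar
  set G := Qinf.dAF αs τs Pstar
  have hlin' : ∀ e : ℝ, 0 < e → WPA1 μ fun n ω => ‖r n • (a n ω - αs) -
      -H.inverse (r n • ((Q n ω).dA αs τs Pstar + G (τhat n ω - τs)))‖ ≤
      e * ‖(r n • ((Q n ω).dA αs τs Pstar, τhat n ω - τs), r n • (P n ω - Pstar))‖ := by
    refine fun e he => (hlin e he).mono ?_
    filter_upwards [hr.eventually_ge_atTop 0] with n hn ω hω
    rw [sub_neg_eq_add, map_smul, ← smul_add, ← Prod.smul_mk, norm_smul, norm_smul,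
      Real.norm_of_nonneg hn]
    calc r n * _ ≤ r n * _ := mul_le_mul_of_nonneg_left hω hn
      _ = _ := by ring
  refine ⟨isLittleOp_of_forall_le_mul hZ hlin', hZ.of_wpa1_le hZ (c := 1 + ‖H.inverse‖ * (1 + ‖G‖))
    (by positivity) ((hlin' 1 one_pos).mono (Eventually.of_forall fun n ω hω => ?_))⟩
  rw [smul_add, ← map_smul G] at hω
  set s := r n • (Q n ω).dA αs τs Pstar
  set t := r n • (τhat n ω - τs)
  have hst : r n • ((Q n ω).dA αs τs Pstar, τhat n ω - τs) = (s, t) := rfl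
  rw [hst] at hω ⊢
  set p := r n • (P n ω - Pstar)
  set d := r n • (a n ω - αs)
  have hz := norm_fst_le ((s, t), p)
  have hs : ‖s‖ ≤ ‖((s, t), p)‖ := (norm_fst_le (s, t)).trans hz
  have ht : ‖t‖ ≤ ‖((s, t), p)‖ := (norm_snd_le (s, t)).trans hz
  have hv : ‖H.inverse (s + G t)‖ ≤ ‖H.inverse‖ * ((1 + ‖G‖) * ‖((s, t), p)‖) := by
    refine (H.inverse.le_opNorm _).trans (mul_le_mul_of_nonneg_left ?_ (norm_nonneg _))
    rw [add_mul, one_mul]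
    exact norm_add_le_of_le hs ((G.le_opNorm _).trans (by gcongr))
  have hd : ‖d‖ ≤ ‖d - -H.inverse (s + G t)‖ + ‖H.inverse (s + G t)‖ := by
    have h := norm_add_le (d - -H.inverse (s + G t)) (-H.inverse (s + G t))
    rwa [sub_add_cancel, norm_neg] at h
  have h0 : 0 ≤ (1 + ‖H.inverse‖ * (1 + ‖G‖)) * ‖((s, t), p)‖ := by positivity
  linarith

/-- Differentiable maps preserve the rate of convergence in probability. -/
lemma isBigOp_smul_comp_sub {E F : Type*} [NormedAddCommGroup E] [NormedSpace ℝ E]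
    [NormedAddCommGroup F] [NormedSpace ℝ F] {Ψ : E → F} {Θ : Set E} {y₀ : E}
    (hΨ : DifferentiableWithinAt ℝ Ψ Θ y₀) {r : ℕ → ℝ} (hr : Tendsto r atTop atTop)
    {Y : ∀ n, Ω n → E} (hmem : WPA1 μ fun n ω => Y n ω ∈ Θ)
    (hY : IsBigOp μ fun n ω => r n • (Y n ω - y₀)) :
    IsBigOp μ fun n ω => r n • (Ψ (Y n ω) - Ψ y₀) := by
  -- Differentiability within Θ at `y₀` gives a Lipschitz-type bound at that point, valid near `y₀`
  -- within Θ.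
  obtain ⟨C, hC0, hC⟩ := hΨ.isBigO_sub.exists_pos
  obtain ⟨ρ, hρ, hball⟩ := Metric.mem_nhdsWithin_iff.1 hC.bound
  refine hY.of_wpa1_le hY hC0.le ((hmem.and
    (isLittleOp_enorm_iff.1 (hY.isLittleOp_of_smul hr) ρ hρ)).mono (Eventually.of_forall ?_))
  rintro n ω ⟨h1, h2⟩
  have h3 : ‖Ψ (Y n ω) - Ψ y₀‖ ≤ C * ‖Y n ω - y₀‖ :=
    hball ⟨by rwa [Metric.mem_ball, dist_eq_norm], h1⟩
  rw [norm_smul, norm_smul]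
  have h4 := mul_le_mul_of_nonneg_left h3 (norm_nonneg (r n))
  have h5 : 0 ≤ C * (‖r n‖ * ‖Y n ω - y₀‖) := by positivity
  linarith

end DDC

theorem theorem3p1 {dα df J S : ℕ} (M : DDC.Model dα df J S)
    (hreg : M.Regular) (hid : M.Identified)
    -- the drifting sequence of DGPs and the true limiting parameter
    (δ : ℝ) (p : ℕ → Fin (J + 1) → Fin S → Fin S → ℝ) (p0 : Fin (J + 1) → Fin S → Fin S → ℝ)
    (Pstar : DDC.CCPVec J S) (fstar : Fin S → Fin (J + 1) → Fin S → ℝ)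
    (hmis : DDC.LocallyMisspecified M δ p p0 Pstar fstar)
    (αs : DDC.Vec dα) (τs : DDC.Vec df)
    (htrue : DDC.IsTrueParameter M Pstar fstar αs τs)
    (hint : αs ∈ interior M.Θα)
    -- the policy function mapping is continuously differentiable around the true value
    (hPsi : ContDiffWithinAt ℝ 1
      (fun y : DDC.Vec dα × DDC.Vec df × DDC.CCPVec J S => M.Psi y.1 y.2.1 y.2.2)
      (M.Θα ×ˢ M.Θf ×ˢ DDC.ccpSpace J S) (αs, τs, Pstar))
    -- probability spaces of the samples, one for each sample size
    {Ω : ℕ → Type*} [∀ n, MeasurableSpace (Ω n)] (μ : ∀ n, Measure (Ω n))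
    [∀ n, IsProbabilityMeasure (μ n)]
    -- criterion functions and conditions on them
    (Q : ∀ n, Ω n → DDC.Criterion dα df J S) (Qinf : DDC.Criterion dα df J S)
    (N : Set (DDC.Vec dα × DDC.Vec df × DDC.CCPVec J S))
    (τhat : ∀ n, Ω n → DDC.Vec df)
    (hQ : DDC.CriterionConditions M μ Q Qinf τhat N αs τs Pstar)
    -- the `K`-stage algorithm
    (K : ℕ) (hK : 1 ≤ K)
    (Phat : ℕ → ∀ n, Ω n → DDC.CCPVec J S) (αhat : ℕ → ∀ n, Ω n → DDC.Vec dα)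
    (hτ_meas : ∀ n, Measurable (τhat n))
    (hP_meas : ∀ k, k < K → ∀ n, Measurable (Phat k n))
    (hα_meas : ∀ k, 1 ≤ k → k ≤ K → ∀ n, Measurable (αhat k n))
    (halg : DDC.WPA1 μ fun n ω =>
      DDC.IsKStage M (Q n ω) K (τhat n ω) (fun k => Phat k n ω) (fun k => αhat k n ω))
    -- limit in distribution of the score and the first step, and rate of the initial CCPs
    {Ω' : Type*} [MeasurableSpace Ω'] (μ' : Measure Ω') [IsProbabilityMeasure μ']
    (ζ : Ω' → DDC.Vec dα × DDC.Vec df)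
    (hζ : TendstoInDistribution
      (fun n ω => DDC.rate δ n • ((Q n ω).dA αs τs Pstar, τhat n ω - τs)) atTop ζ μ μ')
    (hP0 : DDC.IsBigOp μ fun n ω => DDC.rate δ n • (Phat 0 n ω - Pstar)) :
    DDC.IsLittleOp μ (fun n ω =>
      ‖DDC.rate δ n • (αhat K n ω - αs) -
        -(Qinf.dAA αs τs Pstar).inverse (DDC.rate δ n •
          ((Q n ω).dA αs τs Pstar + Qinf.dAF αs τs Pstar (τhat n ω - τs)))‖ₑ) ∧
    TendstoInDistribution (fun n ω => DDC.rate δ n • (αhat K n ω - αs)) atTop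
      (fun ω' => -(Qinf.dAA αs τs Pstar).inverse
        ((ζ ω').1 + Qinf.dAF αs τs Pstar (ζ ω').2)) μ μ' := by
  have hPstar : Pstar ∈ DDC.ccpSpace J S := by
    rw [← htrue.ccp_eq]
    exact hreg.Lam_mem_ccpSpace htrue.mem_α _
  have hfix : M.Psi αs τs Pstar = Pstar := by
    rw [← htrue.ccp_eq]
    exact hreg.Psi_ccp htrue.mem_α htrue.mem_f
  have hr := DDC.tendsto_rate_atTop hmis.δ_pos
  have hS := DDC.isBigOp_of_tendstoInDistribution hζ
  have hτ : DDC.IsBigOp μ fun n ω => DDC.rate δ n • (τhat n ω - τs) := hS.snd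
  have harg : ∀ k < K, DDC.WPA1 μ fun n ω => αhat (k + 1) n ω ∈ M.Θα ∧ ∀ a' ∈ M.Θα,
      Q n ω a' (τhat n ω) (Phat k n ω) ≤ Q n ω (αhat (k + 1) n ω) (τhat n ω) (Phat k n ω) :=
    fun k hk => halg.mono (Eventually.of_forall fun n ω h =>
      ⟨h.mem_α (k + 1) k.succ_pos hk, h.argmax (k + 1) k.succ_pos hk⟩)
  have hstage := fun k hk hPk => hQ.isLittleOp_and_isBigOp_stage hint hPstar hr hS
    (hP_meas k hk) hPk (harg k hk)
  have hPb : ∀ k < K, DDC.IsBigOp μ fun n ω => DDC.rate δ n • (Phat k n ω - Pstar) := by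
    intro k
    induction k with
    | zero => exact fun _ => hP0
    | succ k ih =>
      intro hk
      have hk' : k < K := k.lt_succ_self.trans hk
      -- Ψ is differentiable only within the parameter and CCP spaces. Membership of the stage-`k`
      -- CCPs follows, with probability approaching one, from their consistency and openness.
      obtain ⟨ρ, hρ, hball⟩ := Metric.isOpen_iff.1 (DDC.isOpen_ccpSpace J S) Pstar hPstar
      have hnear := DDC.isLittleOp_enorm_iff.1 ((ih hk').isLittleOp_of_smul hr) ρ hρ
      have hY : DDC.IsBigOp μ fun n ω => DDC.rate δ n •
          ((αhat (k + 1) n ω, τhat n ω, Phat k n ω) - (αs, τs, Pstar)) :=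
        (hstage k hk' (ih hk')).2.prodMk (hτ.prodMk (ih hk'))
      have hΨ := DDC.isBigOp_smul_comp_sub (hPsi.differentiableWithinAt one_ne_zero) hr
        ((halg.and hnear).mono (Eventually.of_forall fun n ω h =>
          ⟨h.1.mem_α (k + 1) k.succ_pos hk.le, h.1.mem_f,
            hball (by rw [Metric.mem_ball, dist_eq_norm]; exact h.2)⟩)) hY
      refine hΨ.of_wpa1_le hΨ zero_le_one (halg.mono (Eventually.of_forall fun n ω h => ?_))
      have hupd : Phat (k + 1) n ω = M.Psi (αhat (k + 1) n ω) (τhat n ω) (Phat k n ω) :=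
        h.update (k + 1) k.succ_pos hk
      -- The fixed-point property makes Ψ at the true value the correct centering for the updated
      -- CCPs.
      rw [hupd, one_mul, hfix]
      exact le_add_of_nonneg_left (norm_nonneg _)
  obtain ⟨k, rfl⟩ : ∃ k, K = k + 1 := ⟨K - 1, by omega⟩
  have hlin := (hstage k k.lt_succ_self (hPb k k.lt_succ_self)).1
  refine ⟨hlin, DDC.tendstoInDistribution_of_isLittleOp_sub ?_
    (fun n => Measurable.aemeasurable ?_) hlin⟩
  swap
  · have hm := hα_meas _ hK le_rfl n
    fun_prop
  have hcont : Continuous fun y : DDC.Vec dα × DDC.Vec df =>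
      -(Qinf.dAA αs τs Pstar).inverse (y.1 + Qinf.dAF αs τs Pstar y.2) := by fun_prop
  have hlim := hζ.continuous_comp hcont
  simpa only [Function.comp_def, Prod.smul_fst, Prod.smul_snd, map_smul, ← smul_add] using hlim
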